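/- **Proposition (Incremental stability).** Let $f:\mathbb R^n\to\mathbb R^n$ be $C^3$ with bounded first, second and third derivatives, and assume that $\dot x=f(x)$ is forward complete. For $t\ge 0$ let $X(x,t)$ denote its solution with $X(x,0)=x$. Write $|\cdot|$ for the Euclidean norm, $f'$ for the Jacobian matrix of $f$, and $A\le B$ for symmetric matrices when $B-A$ is positive semidefinite. Call a $C^2$ map $P$ from $\mathbb R^n$ to the symmetric $n\times n$ matrices a *uniform metric* if there are $\underline p,\overline p>0$ with $\underline p\,I\le P(x)\le\overline p\,I$ for all $x$. Its Riemannian distance $d_P(x_1,x_2)$ is the infimum of the lengths $\int_{a}^{b}\sqrt{\gamma'(s)^{T}P(\gamma(s))\gamma'(s)}\,ds$ over all piecewise $C^1$ paths $\gamma:[a,b]\to\mathbb R^n$ from $x_1$ to $x_2$. Consider the following properties. * **P1** (global exponential incremental stability): there are $k,\lambda>0$ with $|X(x_1,t)-X(x_2,t)|\le k\,|x_1-x_2|\,e^{-\lambda t}$ for all $x_1,x_2\in\mathbb R^n$ and $t\ge 0$. * **P2**: the system $\dot e=f'(x)e,\ \dot x=f(x)$ is forward complete, and there are $k_e,\lambda_e>0$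 such that the $e$-component of its solution from any $(e,x)\in\mathbb R^n\times\mathbb R^n$ satisfies $|E(e,x,t)|\le k_e\,|e|\,e^{-\lambda_e t}$ for all $t\ge 0$. * **P3**: there are a symmetric positive definite matrix $Q$ and a uniform metric $P$ such that, for every $x$, the limit $\mathfrak d_fP(x)=\lim_{h\to0}\big(P(X(x,h))-P(x)\big)/h$ exists (for $h<0$ near $0$, $X(x,h)$ is the solution continued backward in time) and $$\mathfrak d_fP(x)+P(x)f'(x)+f'(x)^{T}P(x)\le -Q .$$ * **P4** (contracting Riemannian distance): there are a uniform metric $P$ and $\lambda>0$ with $d_P(X(x_1,t),X(x_2,t))\le e^{-\lambda t}d_P(x_1,x_2)$ for all $x_1,x_2\in\mathbb R^n$ and $t\ge0$. Then P1 $\Leftrightarrow$ P2 $\Leftrightarrow$ P3 and P1 $\Leftrightarrow$ P4. Moreover, for every pair $(P,Q)$ as in P3, the distance $d_P$ is contracted as in P4 for some $\lambda>0$. -/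

import Mathlib

open Set Filter Topology

noncomputable section

namespace IncrementalStability

/-- The system `ẋ = g x` is forward complete: from every initial condition there is a solution
defined for all `t ≥ 0`. -/
def ForwardComplete {V : Type*} [NormedAddCommGroup V] [NormedSpace ℝ V] (g : V → V) : Prop :=
  ∀ x₀ : V, ∃ u : ℝ → V, u 0 = x₀ ∧ IsIntegralCurveOn u (fun _ => g) (Ici 0)

/-- The vector field of the variational system `ė = f'(x) e`, `ẋ = f x`, in the variables
`z = (e, x)`. -/
def variationalField {V : Type*} [NormedAddCommGroup V] [NormedSpace ℝ V] (f : V → V) :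
    V × V → V × V :=
  fun z => (fderiv ℝ f z.2 z.1, f z.2)

/-- Global exponential incremental stability of `ẋ = f x`. -/
def ExpIncrementallyStable {n : ℕ}
    (f : EuclideanSpace ℝ (Fin n) → EuclideanSpace ℝ (Fin n)) : Prop :=
  ∃ k : ℝ, 0 < k ∧ ∃ lam : ℝ, 0 < lam ∧ ∀ u₁ u₂ : ℝ → EuclideanSpace ℝ (Fin n),
    IsIntegralCurveOn u₁ (fun _ => f) (Ici 0) → IsIntegralCurveOn u₂ (fun _ => f) (Ici 0) →
      ∀ t : ℝ, 0 ≤ t → ‖u₁ t - u₂ t‖ ≤ k * ‖u₁ 0 - u₂ 0‖ * Real.exp (-lam * t)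

/-- The manifold `{e = 0}` is globally exponentially stable for the variational system
`ė = f'(x) e`, `ẋ = f x`: the system is forward complete and the `e`-component of every solution
decays exponentially, uniformly in the `x`-component. -/
def VariationalExpStable {n : ℕ}
    (f : EuclideanSpace ℝ (Fin n) → EuclideanSpace ℝ (Fin n)) : Prop :=
  ForwardComplete (variationalField f) ∧
  ∃ k : ℝ, 0 < k ∧ ∃ lam : ℝ, 0 < lam ∧
    ∀ z : ℝ → EuclideanSpace ℝ (Fin n) × EuclideanSpace ℝ (Fin n),
      IsIntegralCurveOn z (fun _ => variationalField f) (Ici 0) →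
        ∀ t : ℝ, 0 ≤ t → ‖(z t).1‖ ≤ k * ‖(z 0).1‖ * Real.exp (-lam * t)

/-- `L` is the derivative at `x` of `P` along the solutions of `ẋ = f x`:
`L = lim_{h → 0} (P (X(x, h)) - P x) / h`, where `X(x, ·)` is the solution through `x` at time
`0` (which, for a locally Lipschitz `f`, exists and is unique near time `0`). -/
def HasDerivAlong {V W : Type*} [NormedAddCommGroup V] [NormedSpace ℝ V]
    [NormedAddCommGroup W] [NormedSpace ℝ W] (f : V → V) (P : V → W) (x : V) (L : W) : Prop :=
  ∀ u : ℝ → V, u 0 = x → IsIntegralCurveAt u (fun _ => f) 0 →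
    Tendsto (fun h : ℝ => h⁻¹ • (P (u h) - P x)) (𝓝[≠] 0) (𝓝 L)

/-- A `C²` field of symmetric matrices (seen as operators on Euclidean space) that is uniformly
positive definite and bounded: `p I ≤ P x ≤ p' I` for all `x`, with `0 < p` and `0 < p'`.
The order on operators is the Loewner order: `A ≤ B` iff `B - A` is symmetric and positive
semidefinite. In particular each `P x` is symmetric. -/
def IsUniformMetric {n : ℕ}
    (P : EuclideanSpace ℝ (Fin n) →
      EuclideanSpace ℝ (Fin n) →L[ℝ] EuclideanSpace ℝ (Fin n)) : Prop :=
  ContDiff ℝ 2 P ∧ ∃ p : ℝ, 0 < p ∧ ∃ p' : ℝ, 0 < p' ∧ ∀ x,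
    p • ContinuousLinearMap.id ℝ (EuclideanSpace ℝ (Fin n)) ≤ P x ∧
      P x ≤ p' • ContinuousLinearMap.id ℝ (EuclideanSpace ℝ (Fin n))

/-- A symmetric positive definite matrix, seen as an operator on Euclidean space. -/
def IsPosDef {n : ℕ}
    (Q : EuclideanSpace ℝ (Fin n) →L[ℝ] EuclideanSpace ℝ (Fin n)) : Prop :=
  Q.IsSymmetric ∧ ∀ v, v ≠ 0 → 0 < inner ℝ (Q v) v

/-- The field `P` has a derivative `𝔡_f P` along `f` and satisfies
`𝔡_f P(x) + P(x) f'(x) + f'(x)ᵀ P(x) ≤ -Q` for all `x` (Loewner order). -/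
def SatisfiesLyapunovInequality {n : ℕ}
    (f : EuclideanSpace ℝ (Fin n) → EuclideanSpace ℝ (Fin n))
    (P : EuclideanSpace ℝ (Fin n) →
      EuclideanSpace ℝ (Fin n) →L[ℝ] EuclideanSpace ℝ (Fin n))
    (Q : EuclideanSpace ℝ (Fin n) →L[ℝ] EuclideanSpace ℝ (Fin n)) : Prop :=
  ∃ dP : EuclideanSpace ℝ (Fin n) →
      EuclideanSpace ℝ (Fin n) →L[ℝ] EuclideanSpace ℝ (Fin n),
    ∀ x, HasDerivAlong f P x (dP x) ∧
      dP x + P x ∘L fderiv ℝ f x + (fderiv ℝ f x).adjoint ∘L P x ≤ -Q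

/-- Existence of a uniform `C²` metric satisfying the Lyapunov matrix inequality for some
positive definite `Q`. -/
def HasLyapunovMetric {n : ℕ}
    (f : EuclideanSpace ℝ (Fin n) → EuclideanSpace ℝ (Fin n)) : Prop :=
  ∃ Q : EuclideanSpace ℝ (Fin n) →L[ℝ] EuclideanSpace ℝ (Fin n), IsPosDef Q ∧
    ∃ P : EuclideanSpace ℝ (Fin n) →
        EuclideanSpace ℝ (Fin n) →L[ℝ] EuclideanSpace ℝ (Fin n),
      IsUniformMetric P ∧ SatisfiesLyapunovInequality f P Q

/-- `γ` is a continuous, piecewise `C¹` path on `[a, b]`: there is a subdivision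
`a = τ 0 ≤ ⋯ ≤ τ N = b` such that `γ` is `C¹` on each `[τ i, τ (i + 1)]`. -/
def IsPiecewiseC1 {V : Type*} [NormedAddCommGroup V] [NormedSpace ℝ V]
    (γ : ℝ → V) (a b : ℝ) : Prop :=
  ContinuousOn γ (Icc a b) ∧
  ∃ (N : ℕ) (τ : ℕ → ℝ), Monotone τ ∧ τ 0 = a ∧ τ N = b ∧
    ∀ i < N, ContDiffOn ℝ 1 γ (Icc (τ i) (τ (i + 1)))

/-- The length of the path `γ` on `[a, b]` for the metric `P`:
`∫_a^b √(γ'(s)ᵀ P(γ(s)) γ'(s)) ds`. -/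
def pathLength {n : ℕ}
    (P : EuclideanSpace ℝ (Fin n) →
      EuclideanSpace ℝ (Fin n) →L[ℝ] EuclideanSpace ℝ (Fin n))
    (γ : ℝ → EuclideanSpace ℝ (Fin n)) (a b : ℝ) : ℝ :=
  ∫ s in a..b, Real.sqrt (inner ℝ (deriv γ s) (P (γ s) (deriv γ s)))

/-- The Riemannian distance of the metric `P`: the infimum of the lengths of the piecewise `C¹`
paths from `x₁` to `x₂`. -/
def riemannianDist {n : ℕ}
    (P : EuclideanSpace ℝ (Fin n) →
      EuclideanSpace ℝ (Fin n) →L[ℝ] EuclideanSpace ℝ (Fin n))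
    (x₁ x₂ : EuclideanSpace ℝ (Fin n)) : ℝ :=
  sInf {l : ℝ | ∃ (γ : ℝ → EuclideanSpace ℝ (Fin n)) (a b : ℝ), a ≤ b ∧
    IsPiecewiseC1 γ a b ∧ γ a = x₁ ∧ γ b = x₂ ∧ l = pathLength P γ a b}

/-- The Riemannian distance of `P` is exponentially contracted by the flow of `ẋ = f x`. -/
def ContractsDist {n : ℕ}
    (f : EuclideanSpace ℝ (Fin n) → EuclideanSpace ℝ (Fin n))
    (P : EuclideanSpace ℝ (Fin n) →
      EuclideanSpace ℝ (Fin n) →L[ℝ] EuclideanSpace ℝ (Fin n)) : Prop :=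
  ∃ lam : ℝ, 0 < lam ∧ ∀ u₁ u₂ : ℝ → EuclideanSpace ℝ (Fin n),
    IsIntegralCurveOn u₁ (fun _ => f) (Ici 0) → IsIntegralCurveOn u₂ (fun _ => f) (Ici 0) →
      ∀ t : ℝ, 0 ≤ t →
        riemannianDist P (u₁ t) (u₂ t) ≤ Real.exp (-lam * t) * riemannianDist P (u₁ 0) (u₂ 0)

end IncrementalStability

end

/-!
Let `X(x, t)` be the flow of `ẋ = f x` and `Φ(x, t)` the solution of the linearized equation
`Φ̇ = f'(X(x, t)) Φ` with `Φ(x, 0) = I`. All four properties are compared through `Φ`.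

*The flow is smooth.* A Grönwall estimate for the error `X(x, t) - X(y, t) - Φ (x - y)` shows that
`X(·, t)` is `C¹` with derivative `Φ(·, t)` (`IsForwardFlow.hasStrictFDerivAt`). The pair `(X, Φ)`
is itself a flow, that of `tangentField`, so an induction gives a `C^m` flow for a `C^m` field
(`IsForwardFlow.contDiff`). The global existence of `Φ` is that of solutions of linear equations.

*Incremental stability and stability of the variational system* both say that
`‖Φ(x, t)‖ ≤ k exp (-λ t)`: a bound on the derivative of `X(·, t)` is the same as a Lipschitz
bound, and the `e`-component of a solution of the variational system is `Φ e`.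

*A Lyapunov metric from exponential decay of `Φ`.* The metric is the Gramian over a finite horizon,
`P(x) = ∫₀ᵀ Φ(x, t)ᵀ Φ(x, t) dt`, with `T` so large that `‖Φ(x, T)‖² ≤ 1/2`. It is `C²` because it
is a component of the flow at time `T` of the `C²` system `ẋ = f x`, `Φ̇ = f'(x) Φ`, `Ṁ = Φᵀ Φ`
(`IsVariationalFlow.contDiff_gramian`), which avoids differentiating under the integral. The
cocycle identity `Φ(X(x, h), t) Φ(x, h) = Φ(x, t + h)` turns its derivative along the flow into the
boundary terms `Φ(x, T)ᵀ Φ(x, T) - I ≤ -I/2` (`fderiv_gramian_apply`).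

*Decay and contraction from a Lyapunov metric.* Along the variational system the derivative of
`eᵀ P(x) e` is at most `-eᵀ Q e`, so this function decays exponentially
(`SatisfiesLyapunovInequality.exists_inner_le_exp`). The bounds on `P` turn this into exponential
decay of `e`. The velocity of a path that is transported by the flow solves the variational system,
so the lengths of paths, and with them the Riemannian distance, are contracted as well
(`SatisfiesLyapunovInequality.contractsDist`).

*Contraction of a distance implies incremental stability* because the Riemannian distance of a
uniform metric is equivalent to the Euclidean one (`ContractsDist.expIncrementallyStable`).
-/

noncomputable section

namespace IncrementalStability

/-! ### Linear differential equations on `[0, ∞)` -/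

section LinearODE

variable {E : Type*} [NormedAddCommGroup E] [NormedSpace ℝ E]

lemma hasDerivWithinAt_Ici_of_Icc {u : ℝ → E} {v : E} {a b t : ℝ}
    (h : HasDerivWithinAt u v (Icc a b) t) (ht : t ∈ Ico a b) :
    HasDerivWithinAt u v (Ici t) t :=
  h.mono_of_mem_nhdsWithin
    (mem_of_superset (Icc_mem_nhdsGE ht.2) (Icc_subset_Icc_left ht.1))

lemma IsIntegralCurveOn.hasDerivWithinAt_Ici {u : ℝ → E} {v : ℝ → E → E} {a t : ℝ}
    (h : IsIntegralCurveOn u v (Ici a)) (ht : a ≤ t) : HasDerivWithinAt u (v t (u t)) (Ici t) t :=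
  (h t ht).mono (Ici_subset_Ici.2 ht)

lemma exists_isIntegralCurveOn_concat {v : ℝ → E → E} {a b c : ℝ} (hab : a ≤ b) (hbc : b ≤ c)
    {u w : ℝ → E} (hu : IsIntegralCurveOn u v (Icc a b)) (hw : IsIntegralCurveOn w v (Icc b c))
    (huw : u b = w b) : ∃ z : ℝ → E, z a = u a ∧ IsIntegralCurveOn z v (Icc a c) := by
  classical
  set z : ℝ → E := fun t => if t ≤ b then u t else w t with hz
  have zu : ∀ t ≤ b, z t = u t := fun t ht => if_pos ht
  have zw : ∀ t, b ≤ t → z t = w t := by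
    intro t ht
    rcases ht.eq_or_lt with rfl | h
    · rw [zu _ le_rfl, huw]
    · exact if_neg h.not_ge
  have h1 : IsIntegralCurveOn z v (Icc a b) := fun t ht => by
    rw [zu t ht.2]; exact (hu t ht).congr (fun s hs => zu s hs.2) (zu t ht.2)
  have h2 : IsIntegralCurveOn z v (Icc b c) := fun t ht => by
    rw [zw t ht.1]; exact (hw t ht).congr (fun s hs => zw s hs.1) (zw t ht.1)
  refine ⟨z, zu a hab, fun t ht => ?_⟩
  rcases lt_trichotomy t b with h | rfl | h
  · refine (h1 t ⟨ht.1, h.le⟩).mono_of_mem_nhdsWithin ?_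
    filter_upwards [self_mem_nhdsWithin, mem_nhdsWithin_of_mem_nhds (Iio_mem_nhds h)] with s hs hs'
    exact ⟨hs.1, le_of_lt hs'⟩
  · rw [← Icc_union_Icc_eq_Icc hab hbc]
    exact (h1 t ⟨hab, le_rfl⟩).union (h2 t ⟨le_rfl, hbc⟩)
  · refine (h2 t ⟨h.le, ht.2⟩).mono_of_mem_nhdsWithin ?_
    filter_upwards [self_mem_nhdsWithin, mem_nhdsWithin_of_mem_nhds (Ioi_mem_nhds h)] with s hs hs'
    exact ⟨le_of_lt hs', hs.2⟩

lemma linear_eqOn_Icc {A : ℝ → E →L[ℝ] E} {T : ℝ} (hA : ContinuousOn A (Icc 0 T))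
    {u w : ℝ → E}
    (hu : IsIntegralCurveOn u (fun t x => A t x) (Icc 0 T))
    (hw : IsIntegralCurveOn w (fun t x => A t x) (Icc 0 T)) (h0 : u 0 = w 0) :
    EqOn u w (Icc 0 T) := by
  obtain ⟨K, hK⟩ := isCompact_Icc.exists_bound_of_continuousOn hA
  refine ODE_solution_unique_of_mem_Icc_right (K := K.toNNReal) (s := fun _ => univ)
    (v := fun t x => A t x)
    (fun t ht => ?_) hu.continuousOn
    (fun t ht => hasDerivWithinAt_Ici_of_Icc (hu t ⟨ht.1, ht.2.le⟩) ht) (fun _ _ => mem_univ _)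
    hw.continuousOn (fun t ht => hasDerivWithinAt_Ici_of_Icc (hw t ⟨ht.1, ht.2.le⟩) ht)
    (fun _ _ => mem_univ _) h0
  refine ((A t).lipschitz.weaken ?_).lipschitzOnWith
  rw [← norm_toNNReal]
  exact Real.toNNReal_le_toNNReal (hK t ⟨ht.1, ht.2.le⟩)

lemma linear_eqOn_Ici {A : ℝ → E →L[ℝ] E} (hA : ContinuousOn A (Ici 0)) {u w : ℝ → E}
    (hu : IsIntegralCurveOn u (fun t x => A t x) (Ici 0))
    (hw : IsIntegralCurveOn w (fun t x => A t x) (Ici 0)) (h0 : u 0 = w 0) :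
    EqOn u w (Ici 0) := fun _ ht =>
  linear_eqOn_Icc (hA.mono Icc_subset_Ici_self) (hu.mono Icc_subset_Ici_self)
    (hw.mono Icc_subset_Ici_self) h0 ⟨ht, le_rfl⟩

variable [CompleteSpace E]

/-- The length of the interval does not depend on the initial time and value: this is what
linearity adds to the Picard-Lindelöf theorem. -/
lemma exists_isIntegralCurveOn_linear_step {A : ℝ → E →L[ℝ] E} (hA : Continuous A) {K : ℝ}
    (hK : 0 < K) (hAK : ∀ t, ‖A t‖ ≤ K) (a : ℝ) (x₀ : E) :
    ∃ u : ℝ → E, u a = x₀ ∧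
      IsIntegralCurveOn u (fun t x => A t x) (Icc a (a + 1 / (2 * K))) := by
  have hδ : 0 < 1 / (2 * K) := by positivity
  have ha : a ∈ Icc a (a + 1 / (2 * K)) := ⟨le_rfl, by linarith⟩
  -- on the ball of radius `‖x₀‖ + 1` around `x₀` the field is bounded by `K (2 ‖x₀‖ + 1)`
  have hpl : IsPicardLindelof (fun t x => A t x) (⟨a, ha⟩ : Icc a (a + 1 / (2 * K))) x₀
      (‖x₀‖₊ + 1) 0 (K.toNNReal * (2 * ‖x₀‖₊ + 1)) K.toNNReal := by
    refine ⟨fun t _ => ?_, fun x _ => ?_, fun t _ x hx => ?_, ?_⟩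
    · refine ((A t).lipschitz.weaken ?_).lipschitzOnWith
      rw [← NNReal.coe_le_coe, Real.coe_toNNReal _ hK.le]; exact hAK t
    · exact (hA.clm_apply continuous_const).continuousOn
    · push_cast
      rw [Real.coe_toNNReal _ hK.le]
      refine ((A t).le_of_opNorm_le (hAK t) x).trans ?_
      gcongr
      have h1 : ‖x‖ ≤ ‖x₀‖ + ‖x - x₀‖ := norm_le_insert' x x₀
      have h2 : ‖x - x₀‖ ≤ ‖x₀‖ + 1 := by simpa [dist_eq_norm] using hx
      linarith
    · push_cast
      rw [Real.coe_toNNReal _ hK.le]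
      simp only [add_sub_cancel_left, sub_self]
      rw [max_eq_left hδ.le]
      have : K * (2 * ‖x₀‖ + 1) * (1 / (2 * K)) = ‖x₀‖ + 1 / 2 := by field_simp
      rw [this]; linarith
  exact hpl.exists_eq_forall_mem_Icc_hasDerivWithinAt₀

lemma exists_isIntegralCurveOn_linear_Icc {A : ℝ → E →L[ℝ] E} (hA : Continuous A) (x₀ : E)
    (N : ℕ) : ∃ u : ℝ → E, u 0 = x₀ ∧ IsIntegralCurveOn u (fun t x => A t x) (Icc 0 N) := by
  have hN : (0 : ℝ) ≤ N := N.cast_nonneg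
  obtain ⟨K, hK⟩ := isCompact_Icc.exists_bound_of_continuousOn (s := Icc (0 : ℝ) N) hA.continuousOn
  have hK' : 0 < max K 1 := lt_max_of_lt_right one_pos
  -- clamping time to `[0, N]` makes the coefficients globally bounded
  set B : ℝ → E →L[ℝ] E := fun t => A (projIcc (0 : ℝ) N hN t) with hB
  have hBc : Continuous B := hA.comp (continuous_subtype_val.comp continuous_projIcc)
  have hBK : ∀ t, ‖B t‖ ≤ max K 1 := fun t => (hK _ (Subtype.mem _)).trans (le_max_left _ _)
  have key : ∀ k : ℕ, ∃ u : ℝ → E, u 0 = x₀ ∧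
      IsIntegralCurveOn u (fun t x => B t x) (Icc 0 (k * (1 / (2 * max K 1)))) := by
    intro k
    induction k with
    | zero =>
      obtain ⟨u, hu, hu'⟩ := exists_isIntegralCurveOn_linear_step hBc hK' hBK 0 x₀
      exact ⟨u, hu, hu'.mono (Icc_subset_Icc_right (by simp))⟩
    | succ k ih =>
      obtain ⟨u, hu, hu'⟩ := ih
      set b : ℝ := k * (1 / (2 * max K 1)) with hb
      obtain ⟨w, hw, hw'⟩ := exists_isIntegralCurveOn_linear_step hBc hK' hBK b (u b)
      obtain ⟨z, hz, hz'⟩ := exists_isIntegralCurveOn_concat (by positivity)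
        (le_add_of_nonneg_right (by positivity)) hu' hw' hw.symm
      refine ⟨z, hz.trans hu, ?_⟩
      have : ((k + 1 : ℕ) : ℝ) * (1 / (2 * max K 1)) = b + 1 / (2 * max K 1) := by
        rw [hb]; push_cast; ring
      rwa [this]
  obtain ⟨k, hk⟩ := exists_nat_ge ((N : ℝ) / (1 / (2 * max K 1)))
  obtain ⟨u, hu, hu'⟩ := key k
  refine ⟨u, hu, fun t ht => ?_⟩
  have := hu'.mono (Icc_subset_Icc_right ((div_le_iff₀ (by positivity)).1 hk)) t ht
  simpa [hB, projIcc_of_mem hN ht] using this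

/-- Solutions on `[0, N]` agree on overlaps by uniqueness, so they fit together on `[0, ∞)`. -/
theorem exists_isIntegralCurveOn_linear {A : ℝ → E →L[ℝ] E} (hA : ContinuousOn A (Ici 0))
    (x₀ : E) :
    ∃ u : ℝ → E, u 0 = x₀ ∧ IsIntegralCurveOn u (fun t x => A t x) (Ici 0) := by
  set B : ℝ → E →L[ℝ] E := fun t => A (max t 0) with hB
  have hBc : Continuous B := hA.comp_continuous (by fun_prop) (fun t => mem_Ici.2 (le_max_right _ _))
  choose u hu0 hu using exists_isIntegralCurveOn_linear_Icc hBc x₀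
  have heq : ∀ t : ℝ, 0 ≤ t → ∀ N M : ℕ, t ≤ N → t ≤ M → u N t = u M t := fun t ht N M hN hM =>
    linear_eqOn_Icc (T := t) hBc.continuousOn ((hu N).mono (Icc_subset_Icc_right hN))
      ((hu M).mono (Icc_subset_Icc_right hM)) ((hu0 N).trans (hu0 M).symm) ⟨ht, le_rfl⟩
  refine ⟨fun t => u ⌈t⌉₊ t, hu0 _, fun t ht => ?_⟩
  have hlt : t < (⌈t⌉₊ + 1 : ℕ) := (Nat.le_ceil t).trans_lt (by simp)
  have h1 := hu (⌈t⌉₊ + 1) t ⟨ht, hlt.le⟩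
  have hBt : B t = A t := by rw [hB]; simp only [max_eq_left (mem_Ici.1 ht)]
  have hmem : Icc (0 : ℝ) (⌈t⌉₊ + 1 : ℕ) ∈ 𝓝[Ici 0] t := by
    filter_upwards [self_mem_nhdsWithin, mem_nhdsWithin_of_mem_nhds (Iio_mem_nhds hlt)]
      with s hs hs'
    exact ⟨hs, le_of_lt hs'⟩
  have h2 := h1.mono_of_mem_nhdsWithin hmem
  beta_reduce at h2 ⊢
  rw [heq t ht _ ⌈t⌉₊ hlt.le (Nat.le_ceil t), hBt] at h2
  refine h2.congr_of_eventuallyEq_of_mem ?_ ht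
  filter_upwards [hmem] with s hs
  exact heq s hs.1 _ _ (Nat.le_ceil s) hs.2

end LinearODE

/-! ### Smooth dependence of the flow on the initial value -/

section Flow

variable {V : Type*} [NormedAddCommGroup V] [NormedSpace ℝ V]

/-- `X x t` is the value at time `t ≥ 0` of a solution of `ẋ = g x` that starts at `x`. Values at
negative times are irrelevant. -/
def IsForwardFlow (g : V → V) (X : V → ℝ → V) : Prop :=
  ∀ x, X x 0 = x ∧ IsIntegralCurveOn (X x) (fun _ => g) (Ici 0)

/-- `Φ x t` is the solution of the linearization of `ẋ = g x` along `X x` that starts at the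
identity. It is the derivative of `X · t` at `x`: see `IsForwardFlow.hasStrictFDerivAt`. -/
def IsVariationalFlow (g : V → V) (X : V → ℝ → V) (Φ : V → ℝ → V →L[ℝ] V) : Prop :=
  ∀ x, Φ x 0 = ContinuousLinearMap.id ℝ V ∧
    IsIntegralCurveOn (Φ x) (fun t S => fderiv ℝ g (X x t) ∘L S) (Ici 0)

lemma ForwardComplete.exists_isForwardFlow {g : V → V} (h : ForwardComplete g) :
    ∃ X, IsForwardFlow g X := by
  choose X hX using h
  exact ⟨X, hX⟩

lemma IsForwardFlow.continuousOn {g : V → V} {X : V → ℝ → V} (hX : IsForwardFlow g X) (x : V) :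
    ContinuousOn (X x) (Ici 0) := (hX x).2.continuousOn

lemma IsVariationalFlow.continuousOn {g : V → V} {X : V → ℝ → V} {Φ : V → ℝ → V →L[ℝ] V}
    (hΦ : IsVariationalFlow g X Φ) (x : V) : ContinuousOn (Φ x) (Ici 0) := (hΦ x).2.continuousOn

lemma IsForwardFlow.continuousOn_fderiv {g : V → V} (hg : ContDiff ℝ 1 g) {X : V → ℝ → V}
    (hX : IsForwardFlow g X) (x : V) : ContinuousOn (fun t => fderiv ℝ g (X x t)) (Ici 0) :=
  (hg.continuous_fderiv one_ne_zero).comp_continuousOn (hX.continuousOn x)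

lemma IsForwardFlow.exists_isVariationalFlow [CompleteSpace V] {g : V → V} (hg : ContDiff ℝ 1 g)
    {X : V → ℝ → V} (hX : IsForwardFlow g X) : ∃ Φ, IsVariationalFlow g X Φ := by
  have key (x : V) := exists_isIntegralCurveOn_linear
    (A := fun t => ContinuousLinearMap.compL ℝ V V V (fderiv ℝ g (X x t)))
    ((ContinuousLinearMap.continuous _).comp_continuousOn (hX.continuousOn_fderiv hg x))
    (ContinuousLinearMap.id ℝ V)
  choose Φ hΦ using key
  exact ⟨Φ, hΦ⟩

/-- A `C¹` map is strictly differentiable along a compact curve, uniformly in the base point. -/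
lemma exists_tube_norm_sub_sub_le {g : V → V} (hg : ContDiff ℝ 1 g) {u : ℝ → V} {T : ℝ}
    (hu : ContinuousOn u (Icc 0 T)) {ε : ℝ} (hε : 0 < ε) :
    ∃ δ > 0, ∀ t ∈ Icc 0 T, ∀ y ∈ Metric.ball (u t) δ, ∀ z ∈ Metric.ball (u t) δ,
      ‖g y - g z - fderiv ℝ g (u t) (y - z)‖ ≤ ε * ‖y - z‖ := by
  have hc : IsCompact (u '' Icc 0 T) := isCompact_Icc.image_of_continuousOn hu
  have h := hc.uniformContinuousAt_of_continuousAt (fderiv ℝ g)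
    (fun a _ => (hg.continuous_fderiv one_ne_zero).continuousAt) (Metric.dist_mem_uniformity hε)
  obtain ⟨δ, hδ, h⟩ := Metric.mem_uniformity_dist.1 h
  refine ⟨δ, hδ, fun t ht y hy z hz => ?_⟩
  refine (convex_ball (u t) δ).norm_image_sub_le_of_norm_fderiv_le' (𝕜 := ℝ)
    (fun x _ => (hg.differentiable one_ne_zero).differentiableAt) (fun x hx => ?_) hz hy
  have := h (a := u t) (b := x) (by rw [dist_comm]; exact hx) (mem_image_of_mem _ ht)
  rw [← dist_eq_norm, dist_comm]
  exact le_of_lt this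

lemma norm_sub_le_of_norm_sub_sub_le {W : Type*} [NormedAddCommGroup W] [NormedSpace ℝ W]
    {a b : V} {S : V →L[ℝ] W} {a' b' : W} {K ε : ℝ}
    (hS : ‖S‖ ≤ K) (h : ‖a' - b' - S (a - b)‖ ≤ ε * ‖a - b‖) : ‖a' - b'‖ ≤ (K + ε) * ‖a - b‖ := by
  calc ‖a' - b'‖ = ‖(a' - b' - S (a - b)) + S (a - b)‖ := by rw [sub_add_cancel]
    _ ≤ ε * ‖a - b‖ + K * ‖a - b‖ := (norm_add_le _ _).trans (add_le_add h (S.le_of_opNorm_le hS _))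
    _ = (K + ε) * ‖a - b‖ := by ring

lemma IsForwardFlow.hasDerivWithinAt_sub {g : V → V} {X : V → ℝ → V} (hX : IsForwardFlow g X)
    (x y : V) {t : ℝ} (ht : 0 ≤ t) :
    HasDerivWithinAt (fun s => X x s - X y s) (g (X x t) - g (X y t)) (Ici t) t :=
  (IsIntegralCurveOn.hasDerivWithinAt_Ici (hX x).2 ht).sub
    (IsIntegralCurveOn.hasDerivWithinAt_Ici (hX y).2 ht)

/-- Solutions depend continuously on the initial value, uniformly on compact time intervals. -/
lemma IsForwardFlow.exists_ball_forall_mem_ball {g : V → V} (hg : ContDiff ℝ 1 g) {X : V → ℝ → V}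
    (hX : IsForwardFlow g X) (x₀ : V) (T : ℝ) {η : ℝ} (hη : 0 < η) :
    ∃ r > 0, ∀ x ∈ Metric.ball x₀ r, ∀ t ∈ Icc 0 T, X x t ∈ Metric.ball (X x₀ t) η := by
  obtain ⟨K, hK⟩ := isCompact_Icc.exists_bound_of_continuousOn
    ((hX.continuousOn_fderiv hg x₀).mono (Icc_subset_Ici_self : Icc 0 T ⊆ Ici 0))
  obtain ⟨δ, hδ, H⟩ := exists_tube_norm_sub_sub_le hg
    ((hX.continuousOn x₀).mono (Icc_subset_Ici_self : Icc 0 T ⊆ Ici 0)) one_pos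
  set ρ := min δ η / 2 with hρ
  have hρ0 : 0 < ρ := half_pos (lt_min hδ hη)
  have hρδ : ρ < δ := (half_lt_self (lt_min hδ hη)).trans_le (min_le_left _ _)
  have hρη : ρ < η := (half_lt_self (lt_min hδ hη)).trans_le (min_le_right _ _)
  set c := |K| + 2 with hc
  have hc0 : 0 < c := by positivity
  have hB : ∀ t ∈ Icc 0 T, ρ * Real.exp (-c * T) * Real.exp (c * t) ≤ ρ := fun t ht => by
    rw [mul_assoc, ← Real.exp_add]
    refine mul_le_of_le_one_right hρ0.le (Real.exp_le_one_iff.2 ?_)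
    nlinarith [ht.2]
  refine ⟨ρ * Real.exp (-c * T), by positivity, fun x hx t ht => ?_⟩
  have hd : ∀ s, HasDerivAt (fun s => ρ * Real.exp (-c * T) * Real.exp (c * s))
      (ρ * Real.exp (-c * T) * (Real.exp (c * s) * (c * 1))) s := fun s =>
    (((hasDerivAt_id s).const_mul c).exp).const_mul _
  have := image_norm_le_of_norm_deriv_right_lt_deriv_boundary (a := 0) (b := T)
    (f := fun s => X x s - X x₀ s) (f' := fun s => g (X x s) - g (X x₀ s))
    (B := fun s => ρ * Real.exp (-c * T) * Real.exp (c * s))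
    (((hX.continuousOn x).sub (hX.continuousOn x₀)).mono Icc_subset_Ici_self)
    (fun s hs => hX.hasDerivWithinAt_sub x x₀ hs.1)
    (by simpa [(hX x).1, (hX x₀).1, dist_eq_norm] using (Metric.mem_ball.1 hx).le) hd
    (fun s hs hs' => ?_) ht
  · rw [Metric.mem_ball, dist_eq_norm]
    exact (this.trans (hB t ht)).trans_lt hρη
  · -- at a time of contact both solutions lie in the tube, where `g` is Lipschitz
    have hs1 : s ∈ Icc 0 T := ⟨hs.1, hs.2.le⟩
    have h1 : ‖X x s - X x₀ s‖ < δ := by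
      rw [hs']; exact (hB s hs1).trans_lt hρδ
    have h2 := norm_sub_le_of_norm_sub_sub_le ((hK s hs1).trans (le_abs_self K))
      (H s hs1 (X x s) (by rwa [Metric.mem_ball, dist_eq_norm]) (X x₀ s) (Metric.mem_ball_self hδ))
    refine h2.trans_lt ?_
    rw [hs']
    have : 0 < ρ * Real.exp (-c * T) * Real.exp (c * s) := by positivity
    rw [hc] at this ⊢
    nlinarith

/-- The flow of a `C¹` field is strictly differentiable in the initial value: the error
`X x - X y - Φ (x - y)` solves a linear equation whose inhomogeneity is `o (x - y)`. -/
theorem IsForwardFlow.hasStrictFDerivAt {g : V → V} (hg : ContDiff ℝ 1 g) {X : V → ℝ → V}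
    (hX : IsForwardFlow g X) {Φ : V → ℝ → V →L[ℝ] V} (hΦ : IsVariationalFlow g X Φ) (x₀ : V)
    {T : ℝ} (hT : 0 ≤ T) : HasStrictFDerivAt (fun x => X x T) (Φ x₀ T) x₀ := by
  obtain ⟨K', hK'⟩ := isCompact_Icc.exists_bound_of_continuousOn
    ((hX.continuousOn_fderiv hg x₀).mono (Icc_subset_Ici_self : Icc 0 T ⊆ Ici 0))
  set K := |K'| with hKdef
  have hK0 : 0 ≤ K := abs_nonneg _
  have hK : ∀ t ∈ Icc 0 T, ‖fderiv ℝ g (X x₀ t)‖ ≤ K := fun t ht =>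
    (hK' t ht).trans (le_abs_self K')
  have hc := (hX.continuousOn x₀).mono (Icc_subset_Ici_self : Icc 0 T ⊆ Ici 0)
  set M := Real.exp ((K + 1) * T) with hM
  have hM0 : 0 < M := Real.exp_pos _
  have hMt : ∀ t ∈ Icc 0 T, Real.exp ((K + 1) * t) ≤ M := fun t ht =>
    Real.exp_le_exp.2 (mul_le_mul_of_nonneg_left ht.2 (by positivity))
  refine HasStrictFDerivAt.of_isLittleO (Asymptotics.isLittleO_iff.2 fun ε hε => ?_)
  have hε' : 0 < ε / (M * M) := by positivity
  obtain ⟨δ₁, hδ₁, H₁⟩ := exists_tube_norm_sub_sub_le hg hc one_pos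
  obtain ⟨δ₂, hδ₂, H₂⟩ := exists_tube_norm_sub_sub_le hg hc hε'
  obtain ⟨r, hr, hball⟩ := hX.exists_ball_forall_mem_ball hg x₀ T (lt_min hδ₁ hδ₂)
  have hmem : Metric.ball x₀ r ×ˢ Metric.ball x₀ r ∈ 𝓝 (x₀, x₀) :=
    prod_mem_nhds (Metric.ball_mem_nhds _ hr) (Metric.ball_mem_nhds _ hr)
  filter_upwards [hmem]
  rintro ⟨x, y⟩ ⟨hx, hy⟩
  have hx1 := fun t ht => Metric.ball_subset_ball (min_le_left δ₁ δ₂) (hball x hx t ht)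
  have hx2 := fun t ht => Metric.ball_subset_ball (min_le_right δ₁ δ₂) (hball x hx t ht)
  have hy1 := fun t ht => Metric.ball_subset_ball (min_le_left δ₁ δ₂) (hball y hy t ht)
  have hy2 := fun t ht => Metric.ball_subset_ball (min_le_right δ₁ δ₂) (hball y hy t ht)
  have hlip : ∀ t ∈ Icc 0 T, ‖X x t - X y t‖ ≤ M * ‖x - y‖ := fun t ht => by
    have := norm_le_gronwallBound_of_norm_deriv_right_le (a := 0) (b := T)
      (f := fun s => X x s - X y s) (f' := fun s => g (X x s) - g (X y s))
      (δ := ‖x - y‖) (K := K + 1) (ε := 0)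
      (((hX.continuousOn x).sub (hX.continuousOn y)).mono Icc_subset_Ici_self)
      (fun s hs => hX.hasDerivWithinAt_sub x y hs.1) (by simp [(hX x).1, (hX y).1])
      (fun s hs => by
        have hs1 : s ∈ Icc 0 T := ⟨hs.1, hs.2.le⟩
        simpa using norm_sub_le_of_norm_sub_sub_le (hK s hs1)
          (H₁ s hs1 _ (hx1 s hs1) _ (hy1 s hs1))) t ht
    rw [gronwallBound_ε0, sub_zero, mul_comm] at this
    exact this.trans (mul_le_mul_of_nonneg_right (hMt t ht) (norm_nonneg _))
  have hΦd : ∀ t, 0 ≤ t → HasDerivWithinAt (fun s => Φ x₀ s (x - y))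
      (fderiv ℝ g (X x₀ t) (Φ x₀ t (x - y))) (Ici t) t := fun t ht =>
    ((IsIntegralCurveOn.hasDerivWithinAt_Ici (hΦ x₀).2 ht).clm_apply
      (hasDerivWithinAt_const t _ (x - y))).congr_deriv (by simp)
  have := norm_le_gronwallBound_of_norm_deriv_right_le (a := 0) (b := T)
      (f := fun s => X x s - X y s - Φ x₀ s (x - y))
      (f' := fun s => g (X x s) - g (X y s) - fderiv ℝ g (X x₀ s) (Φ x₀ s (x - y)))
      (δ := 0) (K := K + 1) (ε := ε / (M * M) * (M * ‖x - y‖))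
      ((((hX.continuousOn x).sub (hX.continuousOn y)).sub
        ((hΦ.continuousOn x₀).clm_apply continuousOn_const)).mono Icc_subset_Ici_self)
      (fun s hs => (hX.hasDerivWithinAt_sub x y hs.1).sub (hΦd s hs.1))
      (by simp [(hX x).1, (hX y).1, (hΦ x₀).1])
      (fun s hs => by
        have hs1 : s ∈ Icc 0 T := ⟨hs.1, hs.2.le⟩
        have h1 : g (X x s) - g (X y s) - fderiv ℝ g (X x₀ s) (Φ x₀ s (x - y)) =
            (g (X x s) - g (X y s) - fderiv ℝ g (X x₀ s) (X x s - X y s)) +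
              fderiv ℝ g (X x₀ s) (X x s - X y s - Φ x₀ s (x - y)) := by
          rw [map_sub _ (X x s - X y s) (Φ x₀ s (x - y))]; abel
        rw [h1]
        refine (norm_add_le _ _).trans ?_
        have h2 := (H₂ s hs1 _ (hx2 s hs1) _ (hy2 s hs1)).trans
          (mul_le_mul_of_nonneg_left (hlip s hs1) hε'.le)
        have h3 := (fderiv ℝ g (X x₀ s)).le_of_opNorm_le (hK s hs1)
          (X x s - X y s - Φ x₀ s (x - y))
        have h4 := norm_nonneg (X x s - X y s - Φ x₀ s (x - y))
        linarith) T ⟨hT, le_rfl⟩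
  refine this.trans ?_
  rw [gronwallBound_of_K_ne_0 (by positivity)]
  simp only [zero_mul, zero_add, sub_zero]
  rw [← hM]
  have h5 : ε / (M * M) * (M * ‖x - y‖) / (K + 1) ≤ ε / (M * M) * (M * ‖x - y‖) :=
    div_le_self (by positivity) (by linarith)
  calc ε / (M * M) * (M * ‖x - y‖) / (K + 1) * (M - 1)
      ≤ ε / (M * M) * (M * ‖x - y‖) / (K + 1) * M :=
        mul_le_mul_of_nonneg_left (by linarith) (by positivity)
    _ ≤ ε / (M * M) * (M * ‖x - y‖) * M := mul_le_mul_of_nonneg_right h5 hM0.le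
    _ = ε * ‖x - y‖ := by field_simp

lemma contDiff_one_of_hasStrictFDerivAt {W : Type*} [NormedAddCommGroup W] [NormedSpace ℝ W]
    {F : V → W} {F' : V → V →L[ℝ] W}
    (h : ∀ x, HasStrictFDerivAt F (F' x) x) : ContDiff ℝ 1 F := by
  rw [contDiff_one_iff_fderiv]
  refine ⟨fun x => (h x).hasFDerivAt.differentiableAt, ?_⟩
  have hF : fderiv ℝ F = F' := funext fun x => (h x).hasFDerivAt.fderiv
  rw [hF, continuous_iff_continuousAt]
  intro x₀
  rw [Metric.continuousAt_iff']
  intro ε hε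
  obtain ⟨s, hs, hlip⟩ := (h x₀).approximates_deriv_on_nhds
    (c := (ε / 2).toNNReal) (Or.inr (by simpa using hε))
  filter_upwards [eventually_mem_nhds_iff.2 hs] with x hx
  have h1 : HasFDerivAt (fun y => F y - F' x₀ y) (F' x - F' x₀) x :=
    (h x).hasFDerivAt.sub (F' x₀).hasFDerivAt
  have h2 := h1.le_of_lipschitzOn hx (C := (ε / 2).toNNReal)
    (LipschitzOnWith.of_dist_le_mul fun y hy z hz => by
      rw [dist_eq_norm, dist_eq_norm]
      have h3 := hlip y hy z hz
      rwa [map_sub, show F y - F z - (F' x₀ y - F' x₀ z) = F y - F' x₀ y - (F z - F' x₀ z) by abel]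
        at h3)
  rw [dist_eq_norm]
  refine h2.trans_lt ?_
  rw [Real.coe_toNNReal _ (by positivity)]
  linarith

/-- The extended system `ẋ = g x`, `Φ̇ = g'(x) Φ` whose flow carries the derivative of the flow of
`g`. -/
def tangentField (g : V → V) : V × (V →L[ℝ] V) → V × (V →L[ℝ] V) :=
  fun z => (g z.1, fderiv ℝ g z.1 ∘L z.2)

lemma IsVariationalFlow.isForwardFlow_tangentField {g : V → V} {X : V → ℝ → V}
    (hX : IsForwardFlow g X) {Φ : V → ℝ → V →L[ℝ] V} (hΦ : IsVariationalFlow g X Φ) :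
    IsForwardFlow (tangentField g) (fun z t => (X z.1 t, Φ z.1 t ∘L z.2)) := by
  rintro ⟨x, S⟩
  refine ⟨by simp [(hX x).1, (hΦ x).1], fun t ht => ?_⟩
  refine ((hX x).2 t ht).prodMk ?_
  exact (((hΦ x).2 t ht).clm_comp (hasDerivWithinAt_const t _ S)).congr_deriv (by
    ext; simp)

end Flow

/-- The flow of a `C^m` field, `m ≥ 1`, is `C^m` in the initial value: the derivative of the flow is
a component of the flow of `tangentField g`, which is one degree less smooth. -/
theorem IsForwardFlow.contDiff {V : Type*} [NormedAddCommGroup V] [NormedSpace ℝ V]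
    [CompleteSpace V] {m : ℕ} {g : V → V} (hg : ContDiff ℝ (m + 1) g) {X : V → ℝ → V}
    (hX : IsForwardFlow g X) {T : ℝ} (hT : 0 ≤ T) : ContDiff ℝ (m + 1) (fun x => X x T) := by
  induction m generalizing V with
  | zero =>
    simp only [Nat.cast_zero, zero_add] at hg ⊢
    obtain ⟨Φ, hΦ⟩ := hX.exists_isVariationalFlow hg
    exact contDiff_one_of_hasStrictFDerivAt (fun x => hX.hasStrictFDerivAt hg hΦ x hT)
  | succ m ih =>
    push_cast at hg ⊢
    have hg1 : ContDiff ℝ 1 g := hg.of_le (by simp)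
    obtain ⟨Φ, hΦ⟩ := hX.exists_isVariationalFlow hg1
    have hd : ∀ x, HasFDerivAt (fun x => X x T) (Φ x T) x := fun x =>
      (hX.hasStrictFDerivAt hg1 hΦ x hT).hasFDerivAt
    have hG : ContDiff ℝ (m + 1) (tangentField g) :=
      ((hg.of_le (by simp)).comp contDiff_fst).prodMk
        (((hg.fderiv_right le_rfl).comp contDiff_fst).clm_comp contDiff_snd)
    have h1 := ih hG (hΦ.isForwardFlow_tangentField hX)
    rw [contDiff_succ_iff_fderiv]
    refine ⟨fun x => (hd x).differentiableAt, by simp, ?_⟩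
    have h2 : fderiv ℝ (fun x => X x T) = fun x =>
        (X x T, Φ x T ∘L ContinuousLinearMap.id ℝ V).2 := by
      ext1 x; rw [(hd x).fderiv]; simp
    rw [h2]
    exact (h1.snd).comp (contDiff_id.prodMk contDiff_const)

/-! ### The flow property and the variational system -/

section Cocycle

variable {V : Type*} [NormedAddCommGroup V] [NormedSpace ℝ V]

lemma IsForwardFlow.eqOn_of_isIntegralCurveOn {g : V → V} {K : NNReal} (hg : LipschitzWith K g)
    {X : V → ℝ → V} (hX : IsForwardFlow g X) {u : ℝ → V}
    (hu : IsIntegralCurveOn u (fun _ => g) (Ici 0)) {t : ℝ} (ht : 0 ≤ t) : u t = X (u 0) t :=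
  ODE_solution_unique (v := fun _ => g) (fun _ => hg) (hu.continuousOn.mono Icc_subset_Ici_self)
    (fun _ hs => IsIntegralCurveOn.hasDerivWithinAt_Ici hu hs.1)
    ((hX.continuousOn _).mono Icc_subset_Ici_self)
    (fun _ hs => IsIntegralCurveOn.hasDerivWithinAt_Ici (hX _).2 hs.1)
    (hX _).1.symm ⟨ht, le_rfl⟩

lemma hasDerivWithinAt_comp_add_right {W : Type*} [NormedAddCommGroup W] [NormedSpace ℝ W]
    {u : ℝ → W} {u' : W} {t h : ℝ} (hh : 0 ≤ h) (hu : HasDerivWithinAt u u' (Ici 0) (t + h)) :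
    HasDerivWithinAt (fun s => u (s + h)) u' (Ici 0) t := by
  have h1 : HasDerivWithinAt (fun s : ℝ => s + h) 1 (Ici 0) t :=
    ((hasDerivAt_id t).add_const h).hasDerivWithinAt
  simpa [Function.comp_def] using
    HasDerivWithinAt.scomp t hu h1 (fun s hs => add_nonneg (mem_Ici.1 hs) hh)

lemma IsForwardFlow.apply_apply {g : V → V} {K : NNReal} (hg : LipschitzWith K g)
    {X : V → ℝ → V} (hX : IsForwardFlow g X) (x : V) {t h : ℝ} (ht : 0 ≤ t) (hh : 0 ≤ h) :
    X (X x h) t = X x (t + h) := by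
  have := hX.eqOn_of_isIntegralCurveOn hg (u := fun s => X x (s + h)) (fun s hs =>
    hasDerivWithinAt_comp_add_right hh ((hX x).2 (s + h) (add_nonneg hs hh))) ht
  simpa using this.symm

lemma IsVariationalFlow.comp_apply {g : V → V} (hg : ContDiff ℝ 1 g) {K : NNReal}
    (hgK : LipschitzWith K g) {X : V → ℝ → V} (hX : IsForwardFlow g X)
    {Φ : V → ℝ → V →L[ℝ] V} (hΦ : IsVariationalFlow g X Φ) (x : V) {t h : ℝ} (ht : 0 ≤ t)
    (hh : 0 ≤ h) : Φ (X x h) t ∘L Φ x h = Φ x (t + h) := by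
  refine linear_eqOn_Ici
    (A := fun t => ContinuousLinearMap.compL ℝ V V V (fderiv ℝ g (X (X x h) t)))
    (u := fun t => Φ (X x h) t ∘L Φ x h) (w := fun t => Φ x (t + h))
    ((ContinuousLinearMap.continuous _).comp_continuousOn (hX.continuousOn_fderiv hg (X x h)))
    (fun s hs => ?_) (fun s hs => ?_) ?_ ht
  · exact (((hΦ (X x h)).2 s hs).clm_comp (hasDerivWithinAt_const s _ (Φ x h))).congr_deriv (by
      ext; simp)
  · have := hasDerivWithinAt_comp_add_right hh ((hΦ x).2 (s + h) (add_nonneg hs hh))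
    beta_reduce at this ⊢
    rw [hX.apply_apply hgK x hs hh]
    exact this
  · simp [(hΦ (X x h)).1]

/-- Solutions of the variational system are given by the flow and its derivative. -/
lemma IsVariationalFlow.isIntegralCurveOn_variationalField {g : V → V} {X : V → ℝ → V}
    (hX : IsForwardFlow g X) {Φ : V → ℝ → V →L[ℝ] V} (hΦ : IsVariationalFlow g X Φ) (e x : V) :
    IsIntegralCurveOn (fun t => (Φ x t e, X x t)) (fun _ => variationalField g) (Ici 0) :=
  fun t ht => ((((hΦ x).2 t ht).clm_apply (hasDerivWithinAt_const t _ e)).congr_deriv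
    (by simp)).prodMk ((hX x).2 t ht)

lemma IsVariationalFlow.forwardComplete_variationalField {g : V → V} {X : V → ℝ → V}
    (hX : IsForwardFlow g X) {Φ : V → ℝ → V →L[ℝ] V} (hΦ : IsVariationalFlow g X Φ) :
    ForwardComplete (variationalField g) := fun z =>
  ⟨fun t => (Φ z.2 t z.1, X z.2 t), by simp [(hΦ z.2).1, (hX z.2).1],
    hΦ.isIntegralCurveOn_variationalField hX z.1 z.2⟩

lemma isIntegralCurveOn_snd_of_variationalField {g : V → V} {z : ℝ → V × V}
    (hz : IsIntegralCurveOn z (fun _ => variationalField g) (Ici 0)) :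
    IsIntegralCurveOn (fun t => (z t).2) (fun _ => g) (Ici 0) := fun t ht => (hz t ht).snd

lemma IsVariationalFlow.fst_eq {g : V → V} (hg : ContDiff ℝ 1 g) {K : NNReal}
    (hgK : LipschitzWith K g) {X : V → ℝ → V} (hX : IsForwardFlow g X)
    {Φ : V → ℝ → V →L[ℝ] V} (hΦ : IsVariationalFlow g X Φ) {z : ℝ → V × V}
    (hz : IsIntegralCurveOn z (fun _ => variationalField g) (Ici 0)) {t : ℝ} (ht : 0 ≤ t) :
    (z t).1 = Φ (z 0).2 t (z 0).1 := by
  have h2 : ∀ s, 0 ≤ s → (z s).2 = X (z 0).2 s := fun s hs =>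
    hX.eqOn_of_isIntegralCurveOn hgK (isIntegralCurveOn_snd_of_variationalField hz) hs
  refine linear_eqOn_Ici (A := fun t => fderiv ℝ g (X (z 0).2 t)) (u := fun t => (z t).1)
    (w := fun t => Φ (z 0).2 t (z 0).1)
    (hX.continuousOn_fderiv hg _) (fun s hs => ?_) (fun s hs => ?_)
    (by simp [(hΦ (z 0).2).1]) ht
  · have h1 : HasDerivWithinAt (fun t => (z t).1) (fderiv ℝ g (z s).2 (z s).1) (Ici 0) s :=
      (hz s hs).fst
    rwa [h2 s hs] at h1
  · exact (hΦ.isIntegralCurveOn_variationalField hX (z 0).1 (z 0).2 s hs).fst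

lemma hasDerivWithinAt_integral_of_continuousOn_Ici {W : Type*} [NormedAddCommGroup W]
    [NormedSpace ℝ W] [CompleteSpace W] {φ : ℝ → W} (hφ : ContinuousOn φ (Ici 0)) {t : ℝ}
    (ht : 0 ≤ t) : HasDerivWithinAt (fun t => ∫ s in (0 : ℝ)..t, φ s) (φ t) (Ici 0) t := by
  have hc : Continuous (fun s => φ (max s 0)) :=
    hφ.comp_continuous (by fun_prop) (fun s => mem_Ici.2 (le_max_right _ _))
  have h1 := (hc.integral_hasStrictDerivAt 0 t).hasDerivAt.hasDerivWithinAt (s := Ici 0)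
  rw [max_eq_left ht] at h1
  refine h1.congr_of_mem (fun r hr => ?_) ht
  refine intervalIntegral.integral_congr fun s hs => ?_
  rw [uIcc_of_le (mem_Ici.1 hr)] at hs
  simp only [max_eq_left hs.1]

end Cocycle

/-! ### The finite-horizon Gramian -/

section Gramian

variable {V : Type*} [NormedAddCommGroup V] [InnerProductSpace ℝ V] [CompleteSpace V]

/-- The operator `∫₀ᵀ Φ(x, t)ᵀ Φ(x, t) dt`, whose quadratic form at `v` is the integral of
`‖Φ(x, t) v‖²` over `[0, T]`. -/
def gramian (Φ : V → ℝ → V →L[ℝ] V) (T : ℝ) (x : V) : V →L[ℝ] V :=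
  ∫ t in (0 : ℝ)..T, star (Φ x t) * Φ x t

lemma continuousOn_star_mul_self {Ψ : ℝ → V →L[ℝ] V} {s : Set ℝ} (h : ContinuousOn Ψ s) :
    ContinuousOn (fun t => star (Ψ t) * Ψ t) s := h.star.mul h

lemma intervalIntegrable_of_continuousOn_Ici {W : Type*} [NormedAddCommGroup W]
    {φ : ℝ → W} (hφ : ContinuousOn φ (Ici 0)) {a b : ℝ} (ha : 0 ≤ a) (hb : 0 ≤ b) :
    IntervalIntegrable φ MeasureTheory.volume a b :=
  (hφ.mono fun _ hs => (le_min ha hb).trans hs.1).intervalIntegrable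

/-- The Gramian is the last component of the flow of a `C^(m+1)` system, namely `ẋ = g x`,
`Φ̇ = g'(x) Φ`, `Ṁ = Φᵀ Φ`. -/
theorem IsVariationalFlow.contDiff_gramian {m : ℕ} {g : V → V} (hg : ContDiff ℝ (m + 2) g)
    {X : V → ℝ → V} (hX : IsForwardFlow g X) {Φ : V → ℝ → V →L[ℝ] V}
    (hΦ : IsVariationalFlow g X Φ) {T : ℝ} (hT : 0 ≤ T) : ContDiff ℝ (m + 1) (gramian Φ T) := by
  set G : (V × (V →L[ℝ] V)) × (V →L[ℝ] V) → (V × (V →L[ℝ] V)) × (V →L[ℝ] V) :=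
    fun w => (tangentField g w.1, star w.1.2 * w.1.2) with hGdef
  have hstar : ContDiff ℝ (m + 1) (fun S : V →L[ℝ] V => star S) :=
    (starL' ℝ : (V →L[ℝ] V) ≃L[ℝ] (V →L[ℝ] V)).contDiff
  have htan : ContDiff ℝ (m + 1) (tangentField g) :=
    ((hg.of_le (by gcongr; norm_num)).comp contDiff_fst).prodMk
      (((hg.fderiv_right (by rw [add_assoc, one_add_one_eq_two])).comp contDiff_fst).clm_comp
        contDiff_snd)
  have hG : ContDiff ℝ (m + 1) G :=
    (htan.comp contDiff_fst).prodMk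
      ((hstar.comp contDiff_fst.snd).clm_comp contDiff_fst.snd)
  have hflow : IsForwardFlow G (fun w t => ((X w.1.1 t, Φ w.1.1 t ∘L w.1.2),
      w.2 + ∫ s in (0 : ℝ)..t, star (Φ w.1.1 s ∘L w.1.2) * (Φ w.1.1 s ∘L w.1.2))) := by
    rintro ⟨z, M⟩
    have hz := hΦ.isForwardFlow_tangentField hX z
    refine ⟨Prod.ext hz.1 (by simp), fun t ht => (hz.2 t ht).prodMk ?_⟩
    exact (hasDerivWithinAt_integral_of_continuousOn_Ici (continuousOn_star_mul_self
      ((hΦ.continuousOn z.1).clm_comp continuousOn_const)) ht).const_add M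
  have h := (hflow.contDiff hG hT).snd.comp (contDiff_id.prodMk contDiff_const |>.prodMk
    contDiff_const : ContDiff ℝ (m + 1)
      (fun x : V => ((x, ContinuousLinearMap.id ℝ V), (0 : V →L[ℝ] V))))
  change ContDiff ℝ (m + 1) (fun x => ∫ t in (0 : ℝ)..T, star (Φ x t) * Φ x t)
  simpa [Function.comp_def] using h

lemma inner_gramian_apply {g : V → V} {X : V → ℝ → V} {Φ : V → ℝ → V →L[ℝ] V}
    (hΦ : IsVariationalFlow g X Φ) {T : ℝ} (hT : 0 ≤ T) (x v w : V) :
    inner ℝ (gramian Φ T x v) w = ∫ t in (0 : ℝ)..T, inner ℝ (Φ x t v) (Φ x t w) := by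
  have hi := intervalIntegrable_of_continuousOn_Ici
    (continuousOn_star_mul_self (hΦ.continuousOn x)) le_rfl hT
  have h1 := ((innerSL ℝ w) ∘L
    (ContinuousLinearMap.apply ℝ V v : (V →L[ℝ] V) →L[ℝ] V)).intervalIntegral_comp_comm hi
  rw [real_inner_comm]
  simp only [ContinuousLinearMap.comp_apply, ContinuousLinearMap.apply_apply,
    innerSL_apply_apply] at h1
  rw [gramian, ← h1]
  refine intervalIntegral.integral_congr fun t _ => ?_
  change inner ℝ w (ContinuousLinearMap.adjoint (Φ x t) (Φ x t v)) = _
  rw [ContinuousLinearMap.adjoint_inner_right, real_inner_comm]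

lemma star_mul_gramian_mul {g : V → V} (hg : ContDiff ℝ 1 g) {K : NNReal}
    (hgK : LipschitzWith K g) {X : V → ℝ → V} (hX : IsForwardFlow g X)
    {Φ : V → ℝ → V →L[ℝ] V} (hΦ : IsVariationalFlow g X Φ) {T h : ℝ} (hT : 0 ≤ T) (hh : 0 ≤ h)
    (x : V) : star (Φ x h) * (gramian Φ T (X x h) * Φ x h) =
      gramian Φ (h + T) x - gramian Φ h x := by
  have hc := continuousOn_star_mul_self (hΦ.continuousOn x)
  have hi := intervalIntegrable_of_continuousOn_Ici
    (continuousOn_star_mul_self (hΦ.continuousOn (X x h))) le_rfl hT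
  have h1 := ((ContinuousLinearMap.mul ℝ (V →L[ℝ] V) (star (Φ x h))) ∘L
    ((ContinuousLinearMap.mul ℝ (V →L[ℝ] V)).flip (Φ x h))).intervalIntegral_comp_comm hi
  simp only [ContinuousLinearMap.comp_apply, ContinuousLinearMap.flip_apply,
    ContinuousLinearMap.mul_apply'] at h1
  have h2 : ∫ t in (0 : ℝ)..T, star (Φ x h) * (star (Φ (X x h) t) * Φ (X x h) t * Φ x h) =
      ∫ t in (0 : ℝ)..T, star (Φ x (t + h)) * Φ x (t + h) := by
    refine intervalIntegral.integral_congr fun t ht => ?_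
    rw [uIcc_of_le hT] at ht
    have h3 : Φ (X x h) t * Φ x h = Φ x (t + h) := hΦ.comp_apply hg hgK hX x ht.1 hh
    rw [← h3, star_mul]
    simp only [mul_assoc]
  rw [gramian, ← h1, h2, intervalIntegral.integral_comp_add_right (fun t => star (Φ x t) * Φ x t),
    zero_add, add_comm T h, gramian, gramian, eq_sub_iff_add_eq, add_comm]
  exact intervalIntegral.integral_add_adjacent_intervals
    (intervalIntegrable_of_continuousOn_Ici hc le_rfl hh)
    (intervalIntegrable_of_continuousOn_Ici hc hh (add_nonneg hh hT))

/-- The derivative of the Gramian along the flow is a difference of boundary terms: the identity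
`Φ(x, h)ᵀ P(X(x, h)) Φ(x, h) = ∫ₕ^{T+h} Φᵀ Φ` is differentiated at `h = 0`. -/
theorem fderiv_gramian_apply {g : V → V} (hg : ContDiff ℝ 2 g) {K : NNReal}
    (hgK : LipschitzWith K g) {X : V → ℝ → V} (hX : IsForwardFlow g X)
    {Φ : V → ℝ → V →L[ℝ] V} (hΦ : IsVariationalFlow g X Φ) {T : ℝ} (hT : 0 ≤ T) (x : V) :
    fderiv ℝ (gramian Φ T) x (g x) + gramian Φ T x * fderiv ℝ g x +
      star (fderiv ℝ g x) * gramian Φ T x = star (Φ x T) * Φ x T - 1 := by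
  have hg1 : ContDiff ℝ 1 g := hg.of_le (by norm_num)
  have hP : ContDiff ℝ 1 (gramian Φ T) := by
    simpa using hΦ.contDiff_gramian (m := 0) (by simpa using hg) hX hT
  have h0 : Φ x 0 = 1 := (hΦ x).1
  have hd : HasDerivWithinAt (Φ x) (fderiv ℝ g x) (Ici 0) 0 := by
    have := (hΦ x).2 0 self_mem_Ici
    simpa [(hX x).1, (hΦ x).1] using this
  have hdX : HasDerivWithinAt (X x) (g x) (Ici 0) 0 := by
    have := (hX x).2 0 self_mem_Ici
    simpa [(hX x).1] using this
  have hdP : HasDerivWithinAt (fun h => gramian Φ T (X x h)) (fderiv ℝ (gramian Φ T) x (g x))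
      (Ici 0) 0 := by
    have h1 : HasFDerivAt (gramian Φ T) (fderiv ℝ (gramian Φ T) x) (X x 0) := by
      rw [(hX x).1]; exact (hP.differentiable one_ne_zero).differentiableAt.hasFDerivAt
    exact h1.comp_hasDerivWithinAt 0 hdX
  have hL := hd.star.mul (hdP.mul hd)
  have hc := continuousOn_star_mul_self (hΦ.continuousOn x)
  have hR := (hasDerivWithinAt_comp_add_right hT (t := 0)
    (hasDerivWithinAt_integral_of_continuousOn_Ici hc (by simpa using hT))).sub
    (hasDerivWithinAt_integral_of_continuousOn_Ici hc le_rfl)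
  have hLR := hR.congr_of_mem (f₁ := fun h => star (Φ x h) * (gramian Φ T (X x h) * Φ x h))
    (fun h hh => star_mul_gramian_mul hg1 hgK hX hΦ hT hh x) self_mem_Ici
  have := (uniqueDiffOn_Ici (0 : ℝ) 0 self_mem_Ici).eq_deriv _ hL hLR
  simp only [Pi.mul_apply, h0, star_one, one_mul, mul_one, (hX x).1, zero_add] at this
  rw [← this]
  abel

end Gramian

/-! ### Comparison estimates and derivatives along the flow -/

section Comparison

lemma le_mul_exp_of_deriv_le {w w' : ℝ → ℝ} {μ : ℝ}
    (hw : ∀ t, 0 ≤ t → HasDerivWithinAt w (w' t) (Ici 0) t) (h : ∀ t, 0 ≤ t → w' t ≤ μ * w t)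
    {t : ℝ} (ht : 0 ≤ t) : w t ≤ w 0 * Real.exp (μ * t) := by
  have := le_gronwallBound_of_liminf_deriv_right_le (f := w) (f' := w') (δ := w 0) (K := μ)
    (ε := 0) (a := 0) (b := t)
    (fun s hs => ((hw s hs.1).continuousWithinAt).mono Icc_subset_Ici_self)
    (fun s hs r hr => by
      simpa [slope_def_module] using
        ((hw s hs.1).mono (Ici_subset_Ici.2 hs.1)).liminf_right_slope_le hr)
    le_rfl (fun s hs => by simpa using h s hs.1) t ⟨ht, le_rfl⟩
  simpa [gronwallBound_ε0] using this

variable {V : Type*} [NormedAddCommGroup V] [InnerProductSpace ℝ V]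

/-- Solutions of the linearized system cannot decay faster than `exp (-c t)` if `‖g'‖ ≤ c`. -/
lemma norm_sq_mul_exp_le_of_isVariationalFlow {g : V → V} {c : ℝ}
    (hc : ∀ x, ‖fderiv ℝ g x‖ ≤ c) {X : V → ℝ → V} {Φ : V → ℝ → V →L[ℝ] V}
    (hΦ : IsVariationalFlow g X Φ) (x v : V) {t : ℝ} (ht : 0 ≤ t) :
    ‖v‖ ^ 2 * Real.exp (-(2 * c) * t) ≤ ‖Φ x t v‖ ^ 2 := by
  have hd : ∀ s, 0 ≤ s → HasDerivWithinAt (fun s => -‖Φ x s v‖ ^ 2)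
      (-(2 * inner ℝ (Φ x s v) (fderiv ℝ g (X x s) (Φ x s v)))) (Ici 0) s := fun s hs =>
    ((((hΦ x).2 s hs).clm_apply (hasDerivWithinAt_const s _ v)).congr_deriv
      (by simp)).norm_sq.neg
  have h := le_mul_exp_of_deriv_le (μ := -(2 * c)) hd (fun s _ => ?_) ht
  · simp only [(hΦ x).1, ContinuousLinearMap.id_apply] at h
    linarith
  · have h1 := abs_real_inner_le_norm (Φ x s v) (fderiv ℝ g (X x s) (Φ x s v))
    have h2 := (fderiv ℝ g (X x s)).le_of_opNorm_le (hc _) (Φ x s v)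
    have h3 := mul_le_mul_of_nonneg_left h2 (norm_nonneg (Φ x s v))
    have h4 := neg_abs_le (inner ℝ (Φ x s v) (fderiv ℝ g (X x s) (Φ x s v)))
    nlinarith

end Comparison

section DerivAlong

variable {V W : Type*} [NormedAddCommGroup V] [NormedSpace ℝ V]
  [NormedAddCommGroup W] [NormedSpace ℝ W]

lemma hasDerivAlong_fderiv {f : V → V} {P : V → W} {x : V} (hP : DifferentiableAt ℝ P x) :
    HasDerivAlong f P x (fderiv ℝ P x (f x)) := by
  rintro u rfl hu
  have h := hP.hasFDerivAt.comp_hasDerivAt 0 hu.hasDerivAt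
  simpa using hasDerivAt_iff_tendsto_slope_zero.1 h

lemma HasDerivAlong.eq_fderiv [CompleteSpace V] {f : V → V} (hf : ContDiff ℝ 1 f) {P : V → W}
    {x : V} (hP : DifferentiableAt ℝ P x) {L : W} (h : HasDerivAlong f P x L) :
    L = fderiv ℝ P x (f x) := by
  -- a local solution through `x` is needed, since otherwise `HasDerivAlong` is vacuous
  obtain ⟨u, hu0, ε, hε, hu⟩ :=
    hf.contDiffAt (x := x).exists_forall_mem_closedBall_exists_eq_forall_mem_Ioo_hasDerivAt₀ 0
  have hu' : IsIntegralCurveAt u (fun _ => f) 0 :=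
    mem_of_superset (Ioo_mem_nhds (by linarith) (by linarith)) hu
  exact tendsto_nhds_unique (h u hu0 hu') (hasDerivAlong_fderiv hP u hu0 hu')

end DerivAlong

/-! ### Exponential decay from a Lyapunov metric -/

section UniformMetric

variable {n : ℕ}
  {P : EuclideanSpace ℝ (Fin n) → EuclideanSpace ℝ (Fin n) →L[ℝ] EuclideanSpace ℝ (Fin n)}
  {Q : EuclideanSpace ℝ (Fin n) →L[ℝ] EuclideanSpace ℝ (Fin n)}
  {f : EuclideanSpace ℝ (Fin n) → EuclideanSpace ℝ (Fin n)}

lemma IsUniformMetric.exists_bounds (hP : IsUniformMetric P) :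
    ∃ p : ℝ, 0 < p ∧ ∃ p' : ℝ, 0 < p' ∧ ∀ x v,
      p * ‖v‖ ^ 2 ≤ inner ℝ v (P x v) ∧ inner ℝ v (P x v) ≤ p' * ‖v‖ ^ 2 := by
  obtain ⟨-, p, hp, p', hp', h⟩ := hP
  refine ⟨p, hp, p', hp', fun x v => ⟨?_, ?_⟩⟩
  · have := (ContinuousLinearMap.le_def _ _ |>.1 (h x).1).inner_nonneg_right v
    simpa [inner_sub_right, inner_smul_right] using this
  · have := (ContinuousLinearMap.le_def _ _ |>.1 (h x).2).inner_nonneg_right v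
    simpa [inner_sub_right, inner_smul_right] using this

lemma IsUniformMetric.inner_comm (hP : IsUniformMetric P)
    (x v w : EuclideanSpace ℝ (Fin n)) : inner ℝ (P x v) w = inner ℝ v (P x w) := by
  obtain ⟨-, p, _, _, _, h⟩ := hP
  have := (ContinuousLinearMap.le_def _ _ |>.1 (h x).1).inner_left_eq_inner_right v w
  simpa [inner_sub_right, inner_sub_left, inner_smul_right, inner_smul_left] using this

lemma IsPosDef.exists_pos_forall_le_inner (hQ : IsPosDef Q) :
    ∃ q : ℝ, 0 < q ∧ ∀ v, q * ‖v‖ ^ 2 ≤ inner ℝ (Q v) v := by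
  have hcont : Continuous fun v => inner ℝ (Q v) v := Q.continuous.inner continuous_id
  rcases (Metric.sphere (0 : EuclideanSpace ℝ (Fin n)) 1).eq_empty_or_nonempty with he | hne
  · refine ⟨1, one_pos, fun v => ?_⟩
    rcases eq_or_ne v 0 with rfl | hv
    · simp
    · have : ‖v‖⁻¹ • v ∈ Metric.sphere (0 : EuclideanSpace ℝ (Fin n)) 1 := by
        simp [norm_smul, hv]
      simp [he] at this
  · obtain ⟨v₀, hv₀, hmin⟩ := (isCompact_sphere (0 : EuclideanSpace ℝ (Fin n)) 1).exists_isMinOn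
      hne hcont.continuousOn
    have hv₀' : v₀ ≠ 0 := by
      rintro rfl; simp at hv₀
    refine ⟨_, hQ.2 v₀ hv₀', fun v => ?_⟩
    rcases eq_or_ne v 0 with rfl | hv
    · simp
    · have hv' : 0 < ‖v‖ := norm_pos_iff.2 hv
      have h1 : ‖v‖⁻¹ • v ∈ Metric.sphere (0 : EuclideanSpace ℝ (Fin n)) 1 := by
        simp [norm_smul, hv]
      have h2 : inner ℝ (Q v₀) v₀ ≤ inner ℝ (Q (‖v‖⁻¹ • v)) (‖v‖⁻¹ • v) := hmin h1
      rw [map_smul, real_inner_smul_left, real_inner_smul_right] at h2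
      calc _ ≤ ‖v‖⁻¹ * (‖v‖⁻¹ * inner ℝ (Q v) v) * ‖v‖ ^ 2 := by gcongr
        _ = inner ℝ (Q v) v := by field_simp

lemma SatisfiesLyapunovInequality.inner_le (hf : ContDiff ℝ 1 f) (hP : IsUniformMetric P)
    (h : SatisfiesLyapunovInequality f P Q) (x v : EuclideanSpace ℝ (Fin n)) :
    inner ℝ v (fderiv ℝ P x (f x) v) + 2 * inner ℝ (P x v) (fderiv ℝ f x v) ≤
      -inner ℝ (Q v) v := by
  obtain ⟨dP, h⟩ := h
  have h1 := (h x).1.eq_fderiv hf (hP.1.differentiable two_ne_zero).differentiableAt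
  have h2 := (ContinuousLinearMap.le_def _ _ |>.1 (h x).2).inner_nonneg_right v
  rw [← h1]
  simp only [sub_apply, add_apply,
    neg_apply, ContinuousLinearMap.comp_apply, inner_sub_right,
    inner_add_right, inner_neg_right, ContinuousLinearMap.adjoint_inner_right] at h2
  rw [← hP.inner_comm, real_inner_comm (P x v) (fderiv ℝ f x v), real_inner_comm (Q v) v] at h2
  linarith

/-- Along the variational system the function `eᵀ P(x) e` decays exponentially: its derivative is
at most `-eᵀ Q e`. -/
theorem SatisfiesLyapunovInequality.exists_inner_le_exp (hf : ContDiff ℝ 1 f)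
    (hQ : IsPosDef Q) (hP : IsUniformMetric P) (h : SatisfiesLyapunovInequality f P Q) :
    ∃ lam : ℝ, 0 < lam ∧ ∀ z : ℝ → EuclideanSpace ℝ (Fin n) × EuclideanSpace ℝ (Fin n),
      IsIntegralCurveOn z (fun _ => variationalField f) (Ici 0) → ∀ t : ℝ, 0 ≤ t →
        inner ℝ (z t).1 (P (z t).2 (z t).1) ≤
          inner ℝ (z 0).1 (P (z 0).2 (z 0).1) * Real.exp (-lam * t) ^ 2 := by
  obtain ⟨p, hp, p', hp', hb⟩ := hP.exists_bounds
  obtain ⟨q, hq, hQq⟩ := hQ.exists_pos_forall_le_inner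
  refine ⟨q / p' / 2, by positivity, fun z hz t ht => ?_⟩
  have hd : ∀ s, 0 ≤ s → HasDerivWithinAt (fun s => inner ℝ (z s).1 (P (z s).2 (z s).1))
      (inner ℝ (z s).1 (fderiv ℝ P (z s).2 (f (z s).2) (z s).1) +
        2 * inner ℝ (P (z s).2 (z s).1) (fderiv ℝ f (z s).2 (z s).1)) (Ici 0) s := by
    intro s hs
    have h1 : HasDerivWithinAt (fun s => (z s).1) (fderiv ℝ f (z s).2 (z s).1) (Ici 0) s :=
      (hz s hs).fst
    have h2 : HasDerivWithinAt (fun s => (z s).2) (f (z s).2) (Ici 0) s := (hz s hs).snd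
    have h3 : HasDerivWithinAt (fun s => P (z s).2) (fderiv ℝ P (z s).2 (f (z s).2)) (Ici 0) s :=
      (hP.1.differentiable two_ne_zero).differentiableAt.hasFDerivAt.comp_hasDerivWithinAt s h2
    refine (h1.inner ℝ (h3.clm_apply h1)).congr_deriv ?_
    rw [inner_add_right, ← hP.inner_comm, real_inner_comm (P (z s).2 (z s).1)]
    ring
  have := le_mul_exp_of_deriv_le (μ := -(q / p')) hd (fun s _ => ?_) ht
  · rw [← Real.exp_nat_mul]
    convert! this using 3
    push_cast; ring
  · have h1 := h.inner_le hf hP (z s).2 (z s).1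
    have h2 := hQq (z s).1
    have h3 := (hb (z s).2 (z s).1).2
    have h4 : q / p' * inner ℝ (z s).1 (P (z s).2 (z s).1) ≤ q * ‖(z s).1‖ ^ 2 := by
      rw [div_mul_eq_mul_div, div_le_iff₀ hp']
      nlinarith
    linarith

theorem HasLyapunovMetric.exists_norm_fst_le (hf : ContDiff ℝ 1 f) (h : HasLyapunovMetric f) :
    ∃ k : ℝ, 0 < k ∧ ∃ lam : ℝ, 0 < lam ∧
      ∀ z : ℝ → EuclideanSpace ℝ (Fin n) × EuclideanSpace ℝ (Fin n),
        IsIntegralCurveOn z (fun _ => variationalField f) (Ici 0) →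
          ∀ t : ℝ, 0 ≤ t → ‖(z t).1‖ ≤ k * ‖(z 0).1‖ * Real.exp (-lam * t) := by
  obtain ⟨Q, hQ, P, hP, hPQ⟩ := h
  obtain ⟨p, hp, p', hp', hb⟩ := hP.exists_bounds
  obtain ⟨lam, hlam, H⟩ := hPQ.exists_inner_le_exp hf hQ hP
  refine ⟨√(p' / p), by positivity, lam, hlam, fun z hz t ht => ?_⟩
  refine le_of_sq_le_sq ?_ (by positivity)
  rw [mul_pow, mul_pow, Real.sq_sqrt (by positivity)]
  have h1 := (hb (z t).2 (z t).1).1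
  have h2 := (hb (z 0).2 (z 0).1).2
  have h3 := mul_le_mul_of_nonneg_right h2 (sq_nonneg (Real.exp (-lam * t)))
  have h4 := (h1.trans (H z hz t ht)).trans h3
  calc ‖(z t).1‖ ^ 2 = p * ‖(z t).1‖ ^ 2 / p := by field_simp
    _ ≤ p' * ‖(z 0).1‖ ^ 2 * Real.exp (-lam * t) ^ 2 / p := by gcongr
    _ = p' / p * ‖(z 0).1‖ ^ 2 * Real.exp (-lam * t) ^ 2 := by ring

end UniformMetric

/-! ### The Gramian as a Lyapunov metric -/

section GramianMetric

variable {n : ℕ} {f : EuclideanSpace ℝ (Fin n) → EuclideanSpace ℝ (Fin n)}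
  {X : EuclideanSpace ℝ (Fin n) → ℝ → EuclideanSpace ℝ (Fin n)}
  {Φ : EuclideanSpace ℝ (Fin n) → ℝ → EuclideanSpace ℝ (Fin n) →L[ℝ] EuclideanSpace ℝ (Fin n)}

lemma contDiff_two_gramian (hf : ContDiff ℝ 3 f) (hX : IsForwardFlow f X)
    (hΦ : IsVariationalFlow f X Φ) {T : ℝ} (hT : 0 ≤ T) : ContDiff ℝ 2 (gramian Φ T) := by
  have h3 : ((1 : ℕ) : WithTop ℕ∞) + 2 = 3 := by norm_num
  have h2 : ((1 : ℕ) : WithTop ℕ∞) + 1 = 2 := by norm_num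
  exact h2 ▸ hΦ.contDiff_gramian (m := 1) (h3 ▸ hf) hX hT

lemma isUniformMetric_gramian (hf : ContDiff ℝ 3 f) {c : ℝ} (hc : ∀ x, ‖fderiv ℝ f x‖ ≤ c)
    (hX : IsForwardFlow f X) (hΦ : IsVariationalFlow f X Φ) {k : ℝ} (hk : 0 < k)
    (hΦk : ∀ x t, 0 ≤ t → ‖Φ x t‖ ≤ k) {T : ℝ} (hT : 0 < T) :
    IsUniformMetric (gramian Φ T) := by
  have hc0 : 0 ≤ c := (norm_nonneg _).trans (hc 0)
  have hsymm : ∀ x v w, inner ℝ (gramian Φ T x v) w = inner ℝ v (gramian Φ T x w) := by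
    intro x v w
    rw [real_inner_comm (gramian Φ T x w), inner_gramian_apply hΦ hT.le,
      inner_gramian_apply hΦ hT.le]
    simp_rw [real_inner_comm]
  have hint : ∀ x v, IntervalIntegrable (fun t => inner ℝ (Φ x t v) (Φ x t v))
      MeasureTheory.volume 0 T := fun x v =>
    have := (hΦ.continuousOn x).clm_apply (continuousOn_const (c := v))
    intervalIntegrable_of_continuousOn_Ici (this.inner this) le_rfl hT.le
  refine ⟨contDiff_two_gramian hf hX hΦ hT.le,
    T * Real.exp (-(2 * c) * T), by positivity, T * k ^ 2, by positivity, fun x => ⟨?_, ?_⟩⟩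
  · refine ⟨fun v w => ?_, fun v => ?_⟩
    · simp [inner_sub_left, inner_sub_right, inner_smul_left, inner_smul_right, hsymm]
    · simp only [ContinuousLinearMap.reApplyInnerSelf_apply, sub_apply,
        inner_sub_left, smul_apply, ContinuousLinearMap.id_apply,
        real_inner_smul_left, real_inner_self_eq_norm_sq, RCLike.re_to_real, sub_nonneg]
      rw [inner_gramian_apply hΦ hT.le]
      have := intervalIntegral.integral_mono_on hT.le
        (intervalIntegrable_const (c := Real.exp (-(2 * c) * T) * ‖v‖ ^ 2)) (hint x v)
        (fun t ht => by
          rw [real_inner_self_eq_norm_sq, mul_comm]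
          refine le_trans ?_ (norm_sq_mul_exp_le_of_isVariationalFlow hc hΦ x v ht.1)
          exact mul_le_mul_of_nonneg_left (Real.exp_le_exp.2
            (mul_le_mul_of_nonpos_left ht.2 (by linarith))) (sq_nonneg _))
      simpa [mul_assoc, mul_left_comm] using this
  · refine ⟨fun v w => ?_, fun v => ?_⟩
    · simp [inner_sub_left, inner_sub_right, inner_smul_left, inner_smul_right, hsymm]
    · simp only [ContinuousLinearMap.reApplyInnerSelf_apply, sub_apply,
        inner_sub_left, smul_apply, ContinuousLinearMap.id_apply,
        real_inner_smul_left, real_inner_self_eq_norm_sq, RCLike.re_to_real, sub_nonneg]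
      rw [inner_gramian_apply hΦ hT.le]
      have := intervalIntegral.integral_mono_on hT.le (hint x v)
        (intervalIntegrable_const (c := k ^ 2 * ‖v‖ ^ 2))
        (fun t ht => by
          rw [real_inner_self_eq_norm_sq, ← mul_pow]
          gcongr
          exact (Φ x t).le_of_opNorm_le (hΦk x t ht.1) v)
      simpa [mul_assoc, mul_left_comm] using this

/-- A time horizon `T` after which the linearized flow is a contraction by a factor `1/√2` makes
the Gramian a Lyapunov metric, with `Q = I / 2`. -/
lemma satisfiesLyapunovInequality_gramian (hf : ContDiff ℝ 3 f) {K : NNReal}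
    (hfK : LipschitzWith K f) (hX : IsForwardFlow f X) (hΦ : IsVariationalFlow f X Φ) {T : ℝ}
    (hT : 0 ≤ T) (hΦT : ∀ x, ‖Φ x T‖ ^ 2 ≤ 1 / 2) :
    SatisfiesLyapunovInequality f (gramian Φ T)
      ((1 / 2 : ℝ) • ContinuousLinearMap.id ℝ (EuclideanSpace ℝ (Fin n))) := by
  have hP := contDiff_two_gramian hf hX hΦ hT
  refine ⟨fun x => fderiv ℝ (gramian Φ T) x (f x), fun x =>
    ⟨hasDerivAlong_fderiv (hP.differentiable two_ne_zero).differentiableAt, ?_⟩⟩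
  have h := fderiv_gramian_apply (hf.of_le (by norm_num)) hfK hX hΦ hT x
  have h' : fderiv ℝ (gramian Φ T) x (f x) + gramian Φ T x ∘L fderiv ℝ f x +
      (fderiv ℝ f x).adjoint ∘L gramian Φ T x = (Φ x T).adjoint ∘L Φ x T -
        ContinuousLinearMap.id ℝ _ := h
  rw [h', ContinuousLinearMap.le_def]
  refine ⟨fun v w => ?_, fun v => ?_⟩
  · simp [inner_sub_left, inner_sub_right, inner_smul_left, inner_smul_right,
      ContinuousLinearMap.adjoint_inner_left, ContinuousLinearMap.adjoint_inner_right]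
  · simp only [ContinuousLinearMap.reApplyInnerSelf_apply, sub_apply,
      neg_apply, inner_neg_left, ContinuousLinearMap.comp_apply,
      inner_sub_left, smul_apply, ContinuousLinearMap.id_apply,
      real_inner_smul_left, real_inner_self_eq_norm_sq, RCLike.re_to_real,
      ContinuousLinearMap.adjoint_inner_left]
    have h1 : ‖Φ x T v‖ ^ 2 ≤ 1 / 2 * ‖v‖ ^ 2 := by
      calc ‖Φ x T v‖ ^ 2 ≤ (‖Φ x T‖ * ‖v‖) ^ 2 := by gcongr; exact (Φ x T).le_opNorm v
        _ = ‖Φ x T‖ ^ 2 * ‖v‖ ^ 2 := mul_pow _ _ _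
        _ ≤ 1 / 2 * ‖v‖ ^ 2 := by gcongr; exact hΦT x
    linarith

lemma isPosDef_half_smul_id :
    IsPosDef ((1 / 2 : ℝ) • ContinuousLinearMap.id ℝ (EuclideanSpace ℝ (Fin n))) := by
  refine ⟨fun v w => by simp [inner_smul_left, inner_smul_right], fun v hv => ?_⟩
  simp only [smul_apply, ContinuousLinearMap.id_apply, real_inner_smul_left,
    real_inner_self_eq_norm_sq]
  positivity

theorem hasLyapunovMetric_of_norm_le (hf : ContDiff ℝ 3 f) {c : ℝ}
    (hc : ∀ x, ‖fderiv ℝ f x‖ ≤ c) {K : NNReal} (hfK : LipschitzWith K f)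
    (hX : IsForwardFlow f X) (hΦ : IsVariationalFlow f X Φ) {k lam : ℝ} (hk : 0 < k)
    (hlam : 0 < lam) (hΦk : ∀ x t, 0 ≤ t → ‖Φ x t‖ ≤ k * Real.exp (-lam * t)) :
    HasLyapunovMetric f := by
  have htend : Tendsto (fun t : ℝ => (k * Real.exp (-lam * t)) ^ 2) atTop (𝓝 0) := by
    have h1 : Tendsto (fun t : ℝ => -lam * t) atTop atBot :=
      tendsto_id.const_mul_atTop_of_neg (neg_lt_zero.2 hlam)
    simpa using ((Real.tendsto_exp_atBot.comp h1).const_mul k).pow 2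
  obtain ⟨T, hT, hT0⟩ := ((htend.eventually (ge_mem_nhds (show (0 : ℝ) < 1 / 2 by norm_num))).and
    (eventually_gt_atTop 0)).exists
  refine ⟨_, isPosDef_half_smul_id, gramian Φ T,
    isUniformMetric_gramian hf hc hX hΦ hk (fun x t ht => (hΦk x t ht).trans ?_) hT0,
    satisfiesLyapunovInequality_gramian hf hfK hX hΦ hT0.le (fun x => le_trans ?_ hT)⟩
  · exact mul_le_of_le_one_right hk.le (Real.exp_le_one_iff.2 (by nlinarith))
  · gcongr
    exact hΦk x T hT0.le

end GramianMetric

/-! ### Piecewise `C¹` paths -/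

section Paths

variable {V W : Type*} [NormedAddCommGroup V] [NormedSpace ℝ V]
  [NormedAddCommGroup W] [NormedSpace ℝ W] {γ : ℝ → V} {a b : ℝ}

lemma IsPiecewiseC1.comp_contDiff (hγ : IsPiecewiseC1 γ a b) {F : V → W} (hF : ContDiff ℝ 1 F) :
    IsPiecewiseC1 (fun s => F (γ s)) a b := by
  obtain ⟨hc, N, τ, hτ, h0, hN, h⟩ := hγ
  exact ⟨hF.continuous.comp_continuousOn hc, N, τ, hτ, h0, hN,
    fun i hi => hF.comp_contDiffOn (h i hi)⟩

lemma ContDiff.isPiecewiseC1 (hγ : ContDiff ℝ 1 γ) (hab : a ≤ b) : IsPiecewiseC1 γ a b := by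
  refine ⟨hγ.continuous.continuousOn, 1, fun i => if i = 0 then a else b, ?_, by simp, by simp,
    fun _ _ => hγ.contDiffOn⟩
  refine monotone_nat_of_le_succ fun i => ?_
  by_cases hi : i = 0 <;> simp [hi, hab]

/-- A piecewise `C¹` path is differentiable except at the countably many points of a
subdivision. -/
lemma IsPiecewiseC1.exists_countable_differentiableAt (hγ : IsPiecewiseC1 γ a b) :
    ∃ S : Set ℝ, S.Countable ∧ ∀ s ∈ Ioo a b \ S, DifferentiableAt ℝ γ s := by
  classical
  obtain ⟨-, N, τ, -, h0, hN, h⟩ := hγ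
  refine ⟨range τ, countable_range τ, fun s ⟨hs, hsτ⟩ => ?_⟩
  have hex : ∃ j, s < τ j := ⟨N, hN ▸ hs.2⟩
  have hfind := Nat.find_spec hex
  obtain ⟨i, hi⟩ : ∃ i, Nat.find hex = i + 1 := by
    refine Nat.exists_eq_succ_of_ne_zero fun h' => ?_
    rw [h', h0] at hfind
    exact hfind.not_gt hs.1
  have hle : τ i ≤ s := not_lt.1 (Nat.find_min hex (by omega))
  have hlt : τ i < s := lt_of_le_of_ne hle fun h' => hsτ ⟨i, h'⟩
  rw [hi] at hfind
  have hiN : i < N := by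
    have : Nat.find hex ≤ N := Nat.find_min' hex (hN ▸ hs.2)
    omega
  exact ((h i hiN).differentiableOn one_ne_zero).differentiableAt (Icc_mem_nhds hlt hfind)

omit [NormedSpace ℝ W] in
omit [NormedSpace ℝ W] in
lemma IsPiecewiseC1.intervalIntegrable (hγ : IsPiecewiseC1 γ a b) {φ : V → V → W}
    (hφ : Continuous (fun z : V × V => φ z.1 z.2)) :
    IntervalIntegrable (fun s => φ (γ s) (deriv γ s)) MeasureTheory.volume a b := by
  obtain ⟨-, N, τ, hτ, rfl, rfl, h⟩ := hγ
  refine IntervalIntegrable.trans_iterate fun i hi => ?_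
  rcases (hτ i.le_succ).eq_or_lt with heq | hlt
  · rw [heq]
  -- on each piece `deriv γ` agrees, off the end points, with the continuous one-sided derivative
  have hc : ContinuousOn (fun s => φ (γ s) (derivWithin γ (Icc (τ i) (τ (i + 1))) s))
      (Icc (τ i) (τ (i + 1))) :=
    hφ.comp_continuousOn ((h i hi).continuousOn.prodMk
      ((h i hi).continuousOn_derivWithin (uniqueDiffOn_Icc hlt) le_rfl))
  refine (hc.intervalIntegrable_of_Icc hlt.le).congr_uIoo fun s hs => ?_
  rw [uIoo_of_le hlt.le] at hs
  beta_reduce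
  rw [derivWithin_of_mem_nhds (Icc_mem_nhds hs.1 hs.2)]

lemma IsPiecewiseC1.integral_deriv [CompleteSpace V] (hγ : IsPiecewiseC1 γ a b) (hab : a ≤ b) :
    ∫ s in a..b, deriv γ s = γ b - γ a := by
  obtain ⟨S, hS, h⟩ := hγ.exists_countable_differentiableAt
  exact MeasureTheory.integral_eq_of_hasDerivAt_off_countable_of_le γ (deriv γ) hab hS hγ.1
    (fun s hs => (h s hs).hasDerivAt) (hγ.intervalIntegrable (φ := fun _ w => w) continuous_snd)

lemma integral_mono_of_countable_diff {S : Set ℝ} (hS : S.Countable) {φ ψ : ℝ → ℝ} (hab : a ≤ b)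
    (hφ : IntervalIntegrable φ MeasureTheory.volume a b)
    (hψ : IntervalIntegrable ψ MeasureTheory.volume a b)
    (h : ∀ s ∈ Ioo a b \ S, φ s ≤ ψ s) : ∫ s in a..b, φ s ≤ ∫ s in a..b, ψ s := by
  refine intervalIntegral.integral_mono_ae_restrict hab hφ hψ ?_
  rw [← MeasureTheory.restrict_Ioo_eq_restrict_Icc]
  filter_upwards [MeasureTheory.ae_restrict_mem measurableSet_Ioo,
    MeasureTheory.ae_restrict_of_ae (hS.ae_notMem MeasureTheory.volume)] with s hs hs'
  exact h s ⟨hs, hs'⟩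

end Paths

/-! ### The Riemannian distance of a uniform metric -/

section Distance

variable {n : ℕ}
  {P : EuclideanSpace ℝ (Fin n) → EuclideanSpace ℝ (Fin n) →L[ℝ] EuclideanSpace ℝ (Fin n)}
  {γ : ℝ → EuclideanSpace ℝ (Fin n)} {a b : ℝ}

lemma IsPiecewiseC1.intervalIntegrable_speed (hγ : IsPiecewiseC1 γ a b) (hP : Continuous P) :
    IntervalIntegrable (fun s => √(inner ℝ (deriv γ s) (P (γ s) (deriv γ s))))
      MeasureTheory.volume a b :=
  hγ.intervalIntegrable (φ := fun v w => √(inner ℝ w (P v w)))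
    (Real.continuous_sqrt.comp
      (continuous_snd.inner ((hP.comp continuous_fst).clm_apply continuous_snd)))

lemma pathLength_nonneg (hab : a ≤ b) : 0 ≤ pathLength P γ a b :=
  intervalIntegral.integral_nonneg hab fun _ _ => Real.sqrt_nonneg _

lemma sqrt_mul_norm_sub_le_pathLength (hPc : Continuous P) {p : ℝ}
    (hP : ∀ x v, p * ‖v‖ ^ 2 ≤ inner ℝ v (P x v)) (hab : a ≤ b) (hγ : IsPiecewiseC1 γ a b) :
    √p * ‖γ a - γ b‖ ≤ pathLength P γ a b := by
  have hi := hγ.intervalIntegrable (φ := fun _ w => ‖w‖) continuous_snd.norm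
  calc √p * ‖γ a - γ b‖ = √p * ‖∫ s in a..b, deriv γ s‖ := by
        rw [hγ.integral_deriv hab, norm_sub_rev]
    _ ≤ √p * ∫ s in a..b, ‖deriv γ s‖ := by
        gcongr; exact intervalIntegral.norm_integral_le_integral_norm hab
    _ = ∫ s in a..b, √p * ‖deriv γ s‖ := by rw [intervalIntegral.integral_const_mul]
    _ ≤ pathLength P γ a b :=
        intervalIntegral.integral_mono_on hab (hi.const_mul _) (hγ.intervalIntegrable_speed hPc)
          fun s _ => by
            rw [← Real.sqrt_sq (norm_nonneg (deriv γ s)), ← Real.sqrt_mul' _ (sq_nonneg _)]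
            exact Real.sqrt_le_sqrt (hP _ _)

lemma bddBelow_pathLength (x₁ x₂ : EuclideanSpace ℝ (Fin n)) :
    BddBelow {l : ℝ | ∃ (γ : ℝ → EuclideanSpace ℝ (Fin n)) (a b : ℝ), a ≤ b ∧
      IsPiecewiseC1 γ a b ∧ γ a = x₁ ∧ γ b = x₂ ∧ l = pathLength P γ a b} := by
  refine ⟨0, ?_⟩
  rintro _ ⟨γ, a, b, hab, -, -, -, rfl⟩
  exact pathLength_nonneg hab

lemma riemannianDist_le_pathLength (hab : a ≤ b) (hγ : IsPiecewiseC1 γ a b) :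
    riemannianDist P (γ a) (γ b) ≤ pathLength P γ a b :=
  csInf_le (bddBelow_pathLength _ _) ⟨γ, a, b, hab, hγ, rfl, rfl, rfl⟩

/-- A lower bound for the lengths of all paths bounds the distance: there is at least one path,
the segment, so that the infimum is not a junk value. -/
lemma le_riemannianDist {x₁ x₂ : EuclideanSpace ℝ (Fin n)} {d : ℝ}
    (h : ∀ (γ : ℝ → EuclideanSpace ℝ (Fin n)) (a b : ℝ), a ≤ b → IsPiecewiseC1 γ a b →
      γ a = x₁ → γ b = x₂ → d ≤ pathLength P γ a b) : d ≤ riemannianDist P x₁ x₂ := by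
  refine le_csInf ⟨_, fun s => x₁ + s • (x₂ - x₁), 0, 1, zero_le_one,
    ContDiff.isPiecewiseC1 (by fun_prop) zero_le_one, by simp, by simp, rfl⟩ ?_
  rintro _ ⟨γ, a, b, hab, hγ, h1, h2, rfl⟩
  exact h γ a b hab hγ h1 h2

lemma riemannianDist_le_sqrt_mul_norm_sub {p : ℝ}
    (hP : ∀ x v, inner ℝ v (P x v) ≤ p * ‖v‖ ^ 2) (hPc : Continuous P)
    (x₁ x₂ : EuclideanSpace ℝ (Fin n)) : riemannianDist P x₁ x₂ ≤ √p * ‖x₁ - x₂‖ := by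
  set γ : ℝ → EuclideanSpace ℝ (Fin n) := fun s => x₁ + s • (x₂ - x₁) with hγdef
  have hγ : IsPiecewiseC1 γ 0 1 := ContDiff.isPiecewiseC1 (by fun_prop) zero_le_one
  have hd : ∀ s, deriv γ s = x₂ - x₁ := fun s => by
    simpa [hγdef] using (((hasDerivAt_id s).smul_const (x₂ - x₁)).const_add x₁).deriv
  have h0 : γ 0 = x₁ := by simp [hγdef]
  have h1 : γ 1 = x₂ := by simp [hγdef]
  have := riemannianDist_le_pathLength (P := P) zero_le_one hγ
  rw [h0, h1] at this
  refine this.trans ?_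
  have h2 := intervalIntegral.integral_mono_on zero_le_one (hγ.intervalIntegrable_speed hPc)
    (intervalIntegrable_const (c := √p * ‖x₁ - x₂‖)) fun s _ => by
      rw [hd, norm_sub_rev, ← Real.sqrt_sq (norm_nonneg (x₂ - x₁)),
        ← Real.sqrt_mul' _ (sq_nonneg _)]
      exact Real.sqrt_le_sqrt (hP _ _)
  simpa [pathLength] using h2

/-- The flow contracts the length of every path: at each point of the path, the velocity of the
transported path is a solution of the variational system. -/
theorem SatisfiesLyapunovInequality.contractsDist
    {f : EuclideanSpace ℝ (Fin n) → EuclideanSpace ℝ (Fin n)} (hf : ContDiff ℝ 1 f) {K : NNReal}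
    (hfK : LipschitzWith K f)
    {X : EuclideanSpace ℝ (Fin n) → ℝ → EuclideanSpace ℝ (Fin n)} (hX : IsForwardFlow f X)
    {Q : EuclideanSpace ℝ (Fin n) →L[ℝ] EuclideanSpace ℝ (Fin n)} (hQ : IsPosDef Q)
    (hP : IsUniformMetric P) (h : SatisfiesLyapunovInequality f P Q) : ContractsDist f P := by
  obtain ⟨Φ, hΦ⟩ := hX.exists_isVariationalFlow hf
  obtain ⟨lam, hlam, H⟩ := h.exists_inner_le_exp hf hQ hP
  refine ⟨lam, hlam, fun u₁ u₂ hu₁ hu₂ t ht => ?_⟩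
  rw [hX.eqOn_of_isIntegralCurveOn hfK hu₁ ht, hX.eqOn_of_isIntegralCurveOn hfK hu₂ ht,
    mul_comm, ← div_le_iff₀ (Real.exp_pos _)]
  refine le_riemannianDist fun γ a b hab hγ ha hb => ?_
  rw [div_le_iff₀ (Real.exp_pos _), ← ha, ← hb]
  have hXt : ContDiff ℝ 1 (fun x => X x t) :=
    contDiff_one_of_hasStrictFDerivAt fun x => hX.hasStrictFDerivAt hf hΦ x ht
  have hγt := hγ.comp_contDiff hXt
  refine (riemannianDist_le_pathLength hab hγt).trans ?_
  rw [pathLength, pathLength, ← intervalIntegral.integral_mul_const]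
  obtain ⟨S, hS, hdiff⟩ := hγ.exists_countable_differentiableAt
  refine integral_mono_of_countable_diff hS hab (hγt.intervalIntegrable_speed hP.1.continuous)
    ((hγ.intervalIntegrable_speed hP.1.continuous).mul_const _) fun s hs => ?_
  have hd : deriv (fun s => X (γ s) t) s = Φ (γ s) t (deriv γ s) :=
    ((hX.hasStrictFDerivAt hf hΦ (γ s) ht).hasFDerivAt.comp_hasDerivAt s
      (hdiff s hs).hasDerivAt).deriv
  have := H _ (hΦ.isIntegralCurveOn_variationalField hX (deriv γ s) (γ s)) t ht
  simp only [(hX (γ s)).1, (hΦ (γ s)).1, ContinuousLinearMap.id_apply] at this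
  rw [hd]
  refine (Real.sqrt_le_sqrt this).trans_eq ?_
  rw [Real.sqrt_mul' _ (sq_nonneg _), Real.sqrt_sq (Real.exp_pos _).le]

theorem ContractsDist.expIncrementallyStable
    {f : EuclideanSpace ℝ (Fin n) → EuclideanSpace ℝ (Fin n)} (hP : IsUniformMetric P)
    (h : ContractsDist f P) : ExpIncrementallyStable f := by
  obtain ⟨p, hp, p', hp', hb⟩ := hP.exists_bounds
  obtain ⟨lam, hlam, H⟩ := h
  refine ⟨√p' / √p, by positivity, lam, hlam, fun u₁ u₂ hu₁ hu₂ t ht => ?_⟩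
  have h1 : √p * ‖u₁ t - u₂ t‖ ≤ riemannianDist P (u₁ t) (u₂ t) :=
    le_riemannianDist fun γ a b hab hγ ha hb' => by
      rw [← ha, ← hb']
      exact sqrt_mul_norm_sub_le_pathLength hP.1.continuous (fun x v => (hb x v).1) hab hγ
  have h2 := riemannianDist_le_sqrt_mul_norm_sub (fun x v => (hb x v).2) hP.1.continuous
    (u₁ 0) (u₂ 0)
  have h3 := (h1.trans (H u₁ u₂ hu₁ hu₂ t ht)).trans
    (mul_le_mul_of_nonneg_left h2 (Real.exp_pos _).le)
  have hsp : 0 < √p := Real.sqrt_pos.2 hp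
  calc ‖u₁ t - u₂ t‖ = √p * ‖u₁ t - u₂ t‖ / √p := by field_simp
    _ ≤ Real.exp (-lam * t) * (√p' * ‖u₁ 0 - u₂ 0‖) / √p := by gcongr
    _ = √p' / √p * ‖u₁ 0 - u₂ 0‖ * Real.exp (-lam * t) := by ring

end Distance

/-! ### Stability in terms of the linearized flow -/

section Linearization

variable {n : ℕ} {f : EuclideanSpace ℝ (Fin n) → EuclideanSpace ℝ (Fin n)}
  {X : EuclideanSpace ℝ (Fin n) → ℝ → EuclideanSpace ℝ (Fin n)}
  {Φ : EuclideanSpace ℝ (Fin n) → ℝ → EuclideanSpace ℝ (Fin n) →L[ℝ] EuclideanSpace ℝ (Fin n)}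

lemma expIncrementallyStable_iff_norm_le (hf : ContDiff ℝ 1 f) {K : NNReal}
    (hfK : LipschitzWith K f) (hX : IsForwardFlow f X) (hΦ : IsVariationalFlow f X Φ) :
    ExpIncrementallyStable f ↔ ∃ k : ℝ, 0 < k ∧ ∃ lam : ℝ, 0 < lam ∧
      ∀ x t, 0 ≤ t → ‖Φ x t‖ ≤ k * Real.exp (-lam * t) := by
  have hd : ∀ x t, 0 ≤ t → HasFDerivAt (fun x => X x t) (Φ x t) x := fun x t ht =>
    (hX.hasStrictFDerivAt hf hΦ x ht).hasFDerivAt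
  constructor
  · rintro ⟨k, hk, lam, hlam, H⟩
    refine ⟨k, hk, lam, hlam, fun x t ht => ?_⟩
    have hpos : 0 ≤ k * Real.exp (-lam * t) := by positivity
    refine (hd x t ht).le_of_lip' hpos (Eventually.of_forall fun y => ?_)
    have := H (X y) (X x) (hX y).2 (hX x).2 t ht
    rw [(hX y).1, (hX x).1] at this
    exact this.trans_eq (by ring)
  · rintro ⟨k, hk, lam, hlam, H⟩
    refine ⟨k, hk, lam, hlam, fun u₁ u₂ hu₁ hu₂ t ht => ?_⟩
    rw [hX.eqOn_of_isIntegralCurveOn hfK hu₁ ht, hX.eqOn_of_isIntegralCurveOn hfK hu₂ ht]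
    refine (convex_univ.norm_image_sub_le_of_norm_hasFDerivWithin_le
      (fun x _ => (hd x t ht).hasFDerivWithinAt) (fun x _ => H x t ht) (mem_univ _)
      (mem_univ _)).trans_eq (by ring)

lemma variationalExpStable_iff_norm_le (hf : ContDiff ℝ 1 f) {K : NNReal}
    (hfK : LipschitzWith K f) (hX : IsForwardFlow f X) (hΦ : IsVariationalFlow f X Φ) :
    VariationalExpStable f ↔ ∃ k : ℝ, 0 < k ∧ ∃ lam : ℝ, 0 < lam ∧
      ∀ x t, 0 ≤ t → ‖Φ x t‖ ≤ k * Real.exp (-lam * t) := by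
  constructor
  · rintro ⟨-, k, hk, lam, hlam, H⟩
    refine ⟨k, hk, lam, hlam, fun x t ht =>
      ContinuousLinearMap.opNorm_le_bound _ (by positivity) fun e => ?_⟩
    have := H _ (hΦ.isIntegralCurveOn_variationalField hX e x) t ht
    simp only [(hΦ x).1, ContinuousLinearMap.id_apply] at this
    exact this.trans_eq (by ring)
  · rintro ⟨k, hk, lam, hlam, H⟩
    refine ⟨hΦ.forwardComplete_variationalField hX, k, hk, lam, hlam, fun z hz t ht => ?_⟩
    rw [hΦ.fst_eq hf hfK hX hz ht]
    exact ((Φ (z 0).2 t).le_of_opNorm_le (H _ t ht) _).trans_eq (by ring)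

end Linearization

end IncrementalStability

end

open IncrementalStability

theorem proposition4 {n : ℕ} (f : EuclideanSpace ℝ (Fin n) → EuclideanSpace ℝ (Fin n))
    (hf : ContDiff ℝ 3 f)
    (hf1 : ∃ c : ℝ, ∀ x, ‖fderiv ℝ f x‖ ≤ c)
    (hf2 : ∃ c : ℝ, ∀ x, ‖iteratedFDeriv ℝ 2 f x‖ ≤ c)
    (hf3 : ∃ c : ℝ, ∀ x, ‖iteratedFDeriv ℝ 3 f x‖ ≤ c)
    (hcomplete : IncrementalStability.ForwardComplete f) :
    (IncrementalStability.ExpIncrementallyStable f ↔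
      IncrementalStability.VariationalExpStable f) ∧
    (IncrementalStability.VariationalExpStable f ↔
      IncrementalStability.HasLyapunovMetric f) ∧
    (IncrementalStability.ExpIncrementallyStable f ↔
      ∃ P : EuclideanSpace ℝ (Fin n) →
          EuclideanSpace ℝ (Fin n) →L[ℝ] EuclideanSpace ℝ (Fin n),
        IncrementalStability.IsUniformMetric P ∧ IncrementalStability.ContractsDist f P) ∧
    (∀ Q : EuclideanSpace ℝ (Fin n) →L[ℝ] EuclideanSpace ℝ (Fin n),
      IncrementalStability.IsPosDef Q →
      ∀ P : EuclideanSpace ℝ (Fin n) →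
          EuclideanSpace ℝ (Fin n) →L[ℝ] EuclideanSpace ℝ (Fin n),
        IncrementalStability.IsUniformMetric P →
        IncrementalStability.SatisfiesLyapunovInequality f P Q →
        IncrementalStability.ContractsDist f P) := by
  have hf' : ContDiff ℝ 1 f := hf.of_le (by norm_num)
  obtain ⟨c, hc⟩ := hf1
  have hfK : LipschitzWith c.toNNReal f :=
    lipschitzWith_of_nnnorm_fderiv_le (𝕜 := ℝ) (hf.differentiable three_ne_zero) fun x => by
      rw [← NNReal.coe_le_coe]
      exact (hc x).trans (Real.le_coe_toNNReal c)
  obtain ⟨X, hX⟩ := hcomplete.exists_isForwardFlow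
  obtain ⟨Φ, hΦ⟩ := hX.exists_isVariationalFlow hf'
  have h1 := expIncrementallyStable_iff_norm_le hf' hfK hX hΦ
  have h2 := variationalExpStable_iff_norm_le hf' hfK hX hΦ
  have h23 : VariationalExpStable f → HasLyapunovMetric f := fun h => by
    obtain ⟨k, hk, lam, hlam, H⟩ := h2.1 h
    exact hasLyapunovMetric_of_norm_le hf hc hfK hX hΦ hk hlam H
  have h34 : ∀ Q, IsPosDef Q → ∀ P, IsUniformMetric P → SatisfiesLyapunovInequality f P Q →
      ContractsDist f P := fun Q hQ P hP h => h.contractsDist hf' hfK hX hQ hP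
  refine ⟨h1.trans h2.symm,
    ⟨h23, fun h => ⟨hΦ.forwardComplete_variationalField hX, h.exists_norm_fst_le hf'⟩⟩,
    ⟨fun h => ?_, fun ⟨P, hP, h⟩ => h.expIncrementallyStable hP⟩, h34⟩
  obtain ⟨Q, hQ, P, hP, hPQ⟩ := h23 (h2.2 (h1.1 h))
  exact ⟨P, hP, h34 Q hQ P hP hPQ⟩
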